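/- All graphs are finite and simple. For graphs $H,G$ let $\mathcal N(H,G)$ be the number of (not necessarily induced) subgraphs of $G$ isomorphic to $H$ and $\mathrm{inj}(H,G)$ the number of injective homomorphisms from $H$ to $G$; let $\mathrm{ex}(n,H,F)$ be the maximum of $\mathcal N(H,G)$ over all $F$-free $n$-vertex graphs $G$. Let $T(n,r)$ be the complete $r$-partite $n$-vertex graph with parts of order $\lfloor n/r\rfloor$ or $\lceil n/r\rceil$. The edit distance of two $n$-vertex graphs $G,G'$ is the least number of edges that have to be deleted from and added to $G$ to obtain a graph isomorphic to $G'$. For a graph $F$ with $\chi(F)=r+1$, a graph $H$ on $h$ vertices with $\chi(H)\le r$ is called $F$-Turán-stable if for every $\varepsilon>0$ there is $\delta>0$ such that for every $n\ge h$, every $F$-free $n$-vertex graph $G$ with $\mathcal N(H,G)\ge \mathrm{ex}(n,H,F)-\delta n^h$ has edit distance at most $\varepsilon n^2$ to $T(n,r)$. Theorem. Let $H$ be a graph on $h$ vertices with at least one edge, and let $r\ge 300h^9$. Then $\chi(H)\le r$ and $H$ is $K_{r+1}$-Turán-stable. Moreover, for every $\varepsilon>0$ there is $\delta>0$ such that for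 every $n\ge h$, every $K_{r+1}$-free $n$-vertex graph $G$ with $\mathrm{inj}(H,G)\ge \mathrm{inj}(H,T(n,r))-\delta n^h$ has edit distance at most $\varepsilon n^2$ to $T(n,r)$. -/

import Mathlib

namespace TuranStability

open Classical in
/-- The generalized Turán number `ex(n, H, F)`: the largest number of (unlabelled, not necessarily
induced) copies of `H` in an `F`-free graph on `n` vertices. -/
noncomputable def genEx {W U : Type*} (n : ℕ) (H : SimpleGraph W) (F : SimpleGraph U) : ℕ :=
  (Finset.univ.filter fun G : SimpleGraph (Fin n) => F.Free G).sup fun G => G.copyCount H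

/-- The edit distance of two graphs with the same number of vertices: the least number of edges
that have to be deleted from and added to `G` to obtain a graph isomorphic to `G'`. -/
noncomputable def editDist {V : Type*} (G G' : SimpleGraph V) : ℕ :=
  sInf {k | ∃ G'' : SimpleGraph V, Nonempty (G'' ≃g G') ∧
    k = (symmDiff G.edgeSet G''.edgeSet).ncard}

/-- `H` is `F`-Turán-stable, where `r + 1` is the chromatic number of `F`. Host graphs with fewer
vertices than `H` are left out: they contain no copy of `H` at all. -/
def IsTuranStable {W U : Type*} [Fintype W] (H : SimpleGraph W) (F : SimpleGraph U) (r : ℕ) :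
    Prop :=
  F.chromaticNumber = (r + 1 : ℕ) ∧ H.chromaticNumber ≤ r ∧
    ∀ ε : ℝ, 0 < ε → ∃ δ : ℝ, 0 < δ ∧
      ∀ n : ℕ, Fintype.card W ≤ n → ∀ G : SimpleGraph (Fin n), F.Free G →
        (genEx n H F : ℝ) - δ * (n : ℝ) ^ Fintype.card W ≤ (G.copyCount H : ℝ) →
        (editDist G (SimpleGraph.turanGraph n r) : ℝ) ≤ ε * (n : ℝ) ^ 2

end TuranStability

namespace TuranStability

section

open Finset
open scoped Classical

variable {V W : Type*} [Fintype V] [Fintype W]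

/-! Write h for the order of H, n for the order of the host, and F = `extCount W V 2` for the number
of injections with two prescribed values. Everything rests on an inequality for every `K_{r+1}`-free
graph G on n ≥ h vertices: r·(inj(H,T) − inj(H,G)) ≥ F·(a(T) − a(G)), where T is the Turán graph and
a counts ordered adjacent pairs (`turan_bound`). Since F has order n^(h−2), a G with nearly as many
copies of H as T has nearly as many edges as T, and stability of Turán's theorem applies
(`editDist_turanGraph_le`).

The inequality says that T maximises the penalised count r·inj(H,G) − F·a(G). Let M be a maximiser,
with n > r. Nearly every injection into T is a homomorphism, so M has nearly as many, and so does an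
average vertex of M relative to the maximum possible. Replacing any vertex u by a clone of a popular
vertex cannot improve M, hence u also lies in many copies and has only O(h³n/r) non-neighbours
(`card_not_adj_le_of_maximal`).

A degree-majorising partition gives a complete r-partite graph K that misses at most half as many
edges of M as it adds. Because M and K are nearly complete, an added edge is worth at least 3/4 of
the F potential copies for each edge of H, while a deleted one costs at most F, so K wins even
against the penalty unless M = K (`card_injHoms_add_le`). Unbalanced parts are excluded likewise by
moving one vertex (`card_injHoms_move`). So M is the Turán graph. -/

/-- The number of injections of `W` into `V` with `k` prescribed values. -/
noncomputable def extCount (W V : Type*) [Fintype W] [Fintype V] (k : ℕ) : ℕ :=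
  (Fintype.card V - k).descFactorial (Fintype.card W - k)

/-- The injections of the vertices of `H` into those of `G` that preserve adjacency. -/
noncomputable def injHoms (H : SimpleGraph W) (G : SimpleGraph V) : Finset (W ↪ V) :=
  {φ | ∀ a b, H.Adj a b → G.Adj (φ a) (φ b)}

/-- The ordered pairs of adjacent vertices. -/
noncomputable def adjPairs (G : SimpleGraph V) : Finset (V × V) := {p | G.Adj p.1 p.2}

/-- The complete multipartite graph whose parts are the fibres of `f`. -/
def multipartite {V : Type*} (f : V → ℕ) : SimpleGraph V where
  Adj v w := f v ≠ f w
  symm := ⟨fun _ _ h => h.symm⟩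
  loopless := ⟨fun _ h => h rfl⟩

theorem mem_injHoms {H : SimpleGraph W} {G : SimpleGraph V} {φ : W ↪ V} :
    φ ∈ injHoms H G ↔ ∀ a b, H.Adj a b → G.Adj (φ a) (φ b) := by simp [injHoms]

theorem mem_adjPairs {G : SimpleGraph V} {p : V × V} : p ∈ adjPairs G ↔ G.Adj p.1 p.2 := by
  simp [adjPairs]

@[simp] theorem multipartite_adj {V : Type*} {f : V → ℕ} {v w : V} :
    (multipartite f).Adj v w ↔ f v ≠ f w := Iff.rfl

theorem labelledCopyCount_eq_card_injHoms (H : SimpleGraph W) (G : SimpleGraph V) :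
    G.labelledCopyCount H = #(injHoms H G) := by
  rw [SimpleGraph.labelledCopyCount, ← Fintype.card_coe]
  refine Fintype.card_congr ⟨fun f => ⟨f.toEmbedding, ?_⟩,
    fun φ => ⟨⟨φ.1, fun {a b} h => mem_injHoms.1 φ.2 a b h⟩, φ.1.injective⟩, ?_, ?_⟩
  · exact mem_injHoms.2 fun a b h => f.toHom.map_adj h
  · intro f; rfl
  · intro φ; rfl

/-! ### Injections with prescribed values -/

/-- The free part of such an injection is an arbitrary embedding of the complement of the range of
`i` into the complement of the range of `g`. -/
theorem card_extensions {ι : Type*} [Fintype ι] {i : ι → W} {g : ι → V}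
    (hi : Function.Injective i) (hg : Function.Injective g) :
    #{φ : W ↪ V | ∀ x, φ (i x) = g x} = extCount W V (Fintype.card ι) := by
  have key (φ : {φ : W ↪ V // ∀ x, φ (i x) = g x}) (w : {w // w ∉ Set.range i}) :
      φ.1 w ∉ Set.range g := by
    rintro ⟨x, hx⟩
    rw [← φ.2 x] at hx
    exact w.2 ⟨x, φ.1.injective hx⟩
  let ext (ψ : {w // w ∉ Set.range i} ↪ {v // v ∉ Set.range g}) (w : W) : V :=
    if h : ∃ x, i x = w then g h.choose else ψ ⟨w, h⟩
  have ext_pos (ψ) (x : ι) : ext ψ (i x) = g x := by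
    have h : ∃ y, i y = i x := ⟨x, rfl⟩
    simp only [ext, dif_pos h]
    exact congrArg g (hi h.choose_spec)
  have ext_neg (ψ) (w : {w // w ∉ Set.range i}) : ext ψ w = ψ w := dif_neg w.2
  have ext_inj (ψ) : Function.Injective (ext ψ) := by
    intro w w' h
    by_cases h1 : w ∈ Set.range i <;> by_cases h2 : w' ∈ Set.range i
    · obtain ⟨x, rfl⟩ := h1
      obtain ⟨y, rfl⟩ := h2
      rw [ext_pos, ext_pos] at h
      rw [hg h]
    · obtain ⟨x, rfl⟩ := h1
      rw [ext_pos, ext_neg ψ ⟨w', h2⟩] at h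
      exact absurd ⟨x, h⟩ (ψ ⟨w', h2⟩).2
    · obtain ⟨x, rfl⟩ := h2
      rw [ext_pos, ext_neg ψ ⟨w, h1⟩] at h
      exact absurd ⟨x, h.symm⟩ (ψ ⟨w, h1⟩).2
    · rw [ext_neg ψ ⟨w', h2⟩, ext_neg ψ ⟨w, h1⟩] at h
      exact congrArg Subtype.val (ψ.injective (Subtype.ext h))
  have e : {φ : W ↪ V // ∀ x, φ (i x) = g x} ≃
      ({w // w ∉ Set.range i} ↪ {v // v ∉ Set.range g}) :=
    { toFun := fun φ => ⟨fun w => ⟨φ.1 w, key φ w⟩, fun w w' h =>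
          Subtype.ext (φ.1.injective (congrArg Subtype.val h))⟩
      invFun := fun ψ => ⟨⟨ext ψ, ext_inj ψ⟩, ext_pos ψ⟩
      left_inv := fun φ => by
        refine Subtype.ext (Function.Embedding.ext fun w => ?_)
        by_cases h : w ∈ Set.range i
        · obtain ⟨x, rfl⟩ := h
          exact (ext_pos _ x).trans (φ.2 x).symm
        · exact ext_neg _ ⟨w, h⟩
      right_inv := fun ψ => Function.Embedding.ext fun w => Subtype.ext (ext_neg ψ w) }
  rw [← Fintype.card_subtype, Fintype.card_congr e, Fintype.card_embedding_eq, extCount]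
  have h1 : Fintype.card {w // w ∉ Set.range i} = Fintype.card W - Fintype.card ι := by
    rw [Fintype.card_subtype_compl]
    congr 1
    exact (Fintype.card_congr (Equiv.ofInjective i hi)).symm
  have h2 : Fintype.card {v // v ∉ Set.range g} = Fintype.card V - Fintype.card ι := by
    rw [Fintype.card_subtype_compl]
    congr 1
    exact (Fintype.card_congr (Equiv.ofInjective g hg)).symm
  rw [h1, h2]

theorem card_extensions_one (a : W) (u : V) : #{φ : W ↪ V | φ a = u} = extCount W V 1 := by
  have := card_extensions (ι := Unit) (i := fun _ => a) (g := fun _ => u)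
    (fun _ _ _ => rfl) (fun _ _ _ => rfl)
  simpa using this

theorem card_extensions_two {a b : W} {u v : V} (hab : a ≠ b) (huv : u ≠ v) :
    #{φ : W ↪ V | φ a = u ∧ φ b = v} = extCount W V 2 := by
  have := card_extensions (i := ![a, b]) (g := ![u, v])
    (by intro x y h; fin_cases x <;> fin_cases y <;> simp_all [eq_comm])
    (by intro x y h; fin_cases x <;> fin_cases y <;> simp_all [eq_comm])
  simpa [Fin.forall_fin_two] using this

theorem card_extensions_three_le {a b c : W} (u v x : V) (hab : a ≠ b) (hac : a ≠ c) (hbc : b ≠ c) :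
    #{φ : W ↪ V | φ a = u ∧ φ b = v ∧ φ c = x} ≤ extCount W V 3 := by
  by_cases h : u ≠ v ∧ u ≠ x ∧ v ≠ x
  · have := card_extensions (i := ![a, b, c]) (g := ![u, v, x])
      (by intro x y h; fin_cases x <;> fin_cases y <;> simp_all [eq_comm])
      (by intro x y h; fin_cases x <;> fin_cases y <;> simp_all [eq_comm])
    refine le_of_eq ?_
    simpa [Fin.forall_fin_succ] using this
  · rw [Finset.filter_eq_empty_iff.2]
    · simp
    · rintro φ - ⟨rfl, rfl, rfl⟩
      simp [hab, hac, hbc] at h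

theorem card_extensions_four_le {a b c d : W} (u v x y : V) (hab : a ≠ b) (hac : a ≠ c)
    (had : a ≠ d) (hbc : b ≠ c) (hbd : b ≠ d) (hcd : c ≠ d) :
    #{φ : W ↪ V | φ a = u ∧ φ b = v ∧ φ c = x ∧ φ d = y} ≤ extCount W V 4 := by
  by_cases h : u ≠ v ∧ u ≠ x ∧ u ≠ y ∧ v ≠ x ∧ v ≠ y ∧ x ≠ y
  · have := card_extensions (i := ![a, b, c, d]) (g := ![u, v, x, y])
      (by intro x y h; fin_cases x <;> fin_cases y <;> simp_all [eq_comm])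
      (by intro x y h; fin_cases x <;> fin_cases y <;> simp_all [eq_comm])
    refine le_of_eq ?_
    simpa [Fin.forall_fin_succ] using this
  · rw [Finset.filter_eq_empty_iff.2]
    · simp
    · rintro φ - ⟨rfl, rfl, rfl, rfl⟩
      simp [hab, hac, hbc, had, hbd, hcd] at h

theorem extCount_succ {k : ℕ} (hW : k < Fintype.card W) (hV : k < Fintype.card V) :
    extCount W V k = (Fintype.card V - k) * extCount W V (k + 1) := by
  unfold extCount
  obtain ⟨x, hx⟩ : ∃ x, Fintype.card V - k = x + 1 := ⟨Fintype.card V - k - 1, by omega⟩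
  obtain ⟨y, hy⟩ : ∃ y, Fintype.card W - k = y + 1 := ⟨Fintype.card W - k - 1, by omega⟩
  rw [hx, hy, Nat.succ_descFactorial_succ, show Fintype.card V - (k + 1) = x by omega,
    show Fintype.card W - (k + 1) = y by omega]

theorem extCount_pos (h : Fintype.card W ≤ Fintype.card V) (k : ℕ) : 0 < extCount W V k :=
  Nat.descFactorial_pos.2 (by omega)

theorem two_le_card_of_ne {a b : W} (h : a ≠ b) : 2 ≤ Fintype.card W :=
  Fintype.one_lt_card_iff.2 ⟨a, b, h⟩

theorem card_embedding_eq_mul {a b : W} (hab : a ≠ b) (hV : 2 ≤ Fintype.card V) :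
    Fintype.card (W ↪ V) = Fintype.card V * (Fintype.card V - 1) * extCount W V 2 := by
  have hW := two_le_card_of_ne hab
  rw [Fintype.card_embedding_eq, show (Fintype.card V).descFactorial (Fintype.card W)
    = extCount W V 0 from rfl, extCount_succ (by omega) (by omega),
    extCount_succ (by omega) (by omega), Nat.sub_zero, mul_assoc]

/-- Counting the injections that map an ordered pair into a given relation. -/
theorem card_filter_pair_mem {a b : W} (hab : a ≠ b) (R : Finset (V × V))
    (hR : ∀ p ∈ R, p.1 ≠ p.2) :
    #{φ : W ↪ V | (φ a, φ b) ∈ R} = #R * extCount W V 2 := by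
  rw [Finset.card_eq_sum_card_fiberwise (f := fun φ : W ↪ V => (φ a, φ b)) (t := R)]
  · rw [Finset.sum_const_nat (m := extCount W V 2)]
    intro p hp
    rw [← card_extensions_two hab (hR p hp), Finset.filter_filter]
    congr 1
    ext φ
    simp only [mem_filter, mem_univ, true_and]
    constructor
    · rintro ⟨-, rfl⟩; simp
    · rintro ⟨h1, h2⟩
      rw [h1, h2]
      exact ⟨hp, rfl⟩
  · intro φ hφ
    simpa using hφ

/-! ### Copies of H in nearly complete graphs -/

/-- Once the value at `c` is known, at most `D` values remain at `d`. If `c` is `a` or `b`, its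
value is prescribed; otherwise it has at most n ≤ 2(n − 2) values, whence the factor 2. -/
theorem card_extensions_not_adj_le {G : SimpleGraph V} {a b c d : W} {u v : V} (hab : a ≠ b)
    (hda : d ≠ a) (hdb : d ≠ b) (hcd : c ≠ d) {D : ℕ} (hD : ∀ x, #{y | ¬G.Adj x y} ≤ D)
    (hn : 4 ≤ Fintype.card V) :
    #{φ : W ↪ V | φ a = u ∧ φ b = v ∧ ¬G.Adj (φ c) (φ d)} * (Fintype.card V - 3) ≤
      2 * D * extCount W V 2 := by
  have h3 : 3 ≤ Fintype.card W := Fintype.two_lt_card_iff.2 ⟨a, b, d, hab, hda.symm, hdb.symm⟩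
  have e2 : extCount W V 2 = (Fintype.card V - 2) * extCount W V 3 :=
    extCount_succ (by omega) (by omega)
  have three (x : V) (h : #{φ : W ↪ V | φ a = u ∧ φ b = v ∧ ¬G.Adj (φ c) (φ d)} ≤
      ∑ y ∈ ({y | ¬G.Adj x y} : Finset V), #{φ : W ↪ V | φ a = u ∧ φ b = v ∧ φ d = y}) :
      #{φ : W ↪ V | φ a = u ∧ φ b = v ∧ ¬G.Adj (φ c) (φ d)} * (Fintype.card V - 3) ≤
      2 * D * extCount W V 2 := by
    have h1 : #{φ : W ↪ V | φ a = u ∧ φ b = v ∧ ¬G.Adj (φ c) (φ d)} ≤ D * extCount W V 3 := by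
      refine h.trans ((Finset.sum_le_card_nsmul _ _ _ fun y _ =>
        card_extensions_three_le u v y hab hda.symm hdb.symm).trans ?_)
      exact Nat.mul_le_mul_right _ (hD x)
    calc _ ≤ D * extCount W V 3 * (Fintype.card V - 2) := Nat.mul_le_mul h1 (by omega)
      _ = D * extCount W V 2 := by rw [e2]; ring
      _ ≤ 2 * D * extCount W V 2 := Nat.mul_le_mul_right _ (by omega)
  by_cases hca : c = a
  · subst hca
    refine three u ?_
    refine le_trans (card_le_card fun φ hφ => ?_) card_biUnion_le
    simp only [mem_filter, mem_univ, true_and, mem_biUnion] at hφ ⊢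
    exact ⟨φ d, by rw [← hφ.1]; exact hφ.2.2, hφ.1, hφ.2.1, rfl⟩
  by_cases hcb : c = b
  · subst hcb
    refine three v ?_
    refine le_trans (card_le_card fun φ hφ => ?_) card_biUnion_le
    simp only [mem_filter, mem_univ, true_and, mem_biUnion] at hφ ⊢
    exact ⟨φ d, by rw [← hφ.2.1]; exact hφ.2.2, hφ.1, hφ.2.1, rfl⟩
  have h4 : 4 ≤ Fintype.card W := by
    have : #({a, b, c, d} : Finset W) = 4 := by
      rw [card_insert_of_notMem, card_insert_of_notMem, card_insert_of_notMem, card_singleton] <;>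
        simp_all [eq_comm]
    exact this ▸ card_le_univ _
  have e3 : extCount W V 3 = (Fintype.card V - 3) * extCount W V 4 :=
    extCount_succ (by omega) (by omega)
  have h1 : #{φ : W ↪ V | φ a = u ∧ φ b = v ∧ ¬G.Adj (φ c) (φ d)} ≤
      Fintype.card V * (D * extCount W V 4) := by
    calc #{φ : W ↪ V | φ a = u ∧ φ b = v ∧ ¬G.Adj (φ c) (φ d)}
        ≤ ∑ x : V, ∑ y ∈ ({y | ¬G.Adj x y} : Finset V),
            #{φ : W ↪ V | φ a = u ∧ φ b = v ∧ φ c = x ∧ φ d = y} := by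
          refine le_trans (card_le_card (t := univ.biUnion fun x : V =>
            ({y | ¬G.Adj x y} : Finset V).biUnion fun y =>
              {φ : W ↪ V | φ a = u ∧ φ b = v ∧ φ c = x ∧ φ d = y}) fun φ hφ => ?_)
            (card_biUnion_le.trans (sum_le_sum fun x _ => card_biUnion_le))
          simp only [mem_filter, mem_univ, true_and, mem_biUnion] at hφ ⊢
          exact ⟨φ c, φ d, hφ.2.2, hφ.1, hφ.2.1, rfl, rfl⟩
      _ ≤ ∑ x : V, D * extCount W V 4 := sum_le_sum fun x _ =>
          (Finset.sum_le_card_nsmul _ _ _ fun y _ => card_extensions_four_le u v x y hab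
            (Ne.symm hca) hda.symm (Ne.symm hcb) hdb.symm hcd).trans
            (Nat.mul_le_mul_right _ (hD x))
      _ = _ := by simp
  calc _ ≤ Fintype.card V * (D * extCount W V 4) * (Fintype.card V - 3) :=
        Nat.mul_le_mul_right _ h1
    _ ≤ (2 * (Fintype.card V - 2)) * (D * extCount W V 4) * (Fintype.card V - 3) := by
        gcongr; omega
    _ = _ := by rw [e2, e3]; ring

/-- In a graph with few non-adjacent pairs at each vertex, at least three quarters of the
injections with two prescribed values respect all edges of `H` but the prescribed one. -/
theorem three_mul_extCount_le {H : SimpleGraph W} {G : SimpleGraph V} {a b : W} {u v : V}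
    (hab : a ≠ b) (huv : u ≠ v) {D : ℕ} (hD : ∀ x, #{y | ¬G.Adj x y} ≤ D)
    (hn : 8 * Fintype.card W ^ 2 * D + 4 ≤ Fintype.card V) :
    3 * extCount W V 2 ≤ 4 * #{φ : W ↪ V | φ a = u ∧ φ b = v ∧ ∀ c d, H.Adj c d →
      (c = a ∧ d = b) ∨ (c = b ∧ d = a) ∨ G.Adj (φ c) (φ d)} := by
  set good : Finset (W ↪ V) := {φ | φ a = u ∧ φ b = v ∧ ∀ c d, H.Adj c d →
      (c = a ∧ d = b) ∨ (c = b ∧ d = a) ∨ G.Adj (φ c) (φ d)} with hgood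
  -- Every edge of H other than ab has an end outside {a, b}; that end is taken as the second entry.
  set P : Finset (W × W) := {p | p.2 ≠ a ∧ p.2 ≠ b ∧ p.1 ≠ p.2} with hP
  set bad : Finset (W ↪ V) := P.biUnion fun p =>
    {φ : W ↪ V | φ a = u ∧ φ b = v ∧ ¬G.Adj (φ p.1) (φ p.2)} with hbad
  have h1 : extCount W V 2 ≤ #good + #bad := by
    rw [← card_extensions_two hab huv]
    refine (card_le_card fun φ hφ => ?_).trans (card_union_le _ _)
    simp only [mem_filter, mem_univ, true_and] at hφ
    rw [mem_union]
    by_contra! hc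
    obtain ⟨hc1, hc2⟩ := hc
    refine hc1 ?_
    simp only [hgood, mem_filter, mem_univ, true_and]
    refine ⟨hφ.1, hφ.2, fun c d hcd => ?_⟩
    by_contra! hne
    apply hc2
    simp only [hbad, hP, mem_biUnion, mem_filter, mem_univ, true_and]
    by_cases hd : d ≠ a ∧ d ≠ b
    · exact ⟨(c, d), ⟨hd.1, hd.2, hcd.ne⟩, hφ.1, hφ.2, hne.2.2⟩
    · refine ⟨(d, c), ⟨?_, ?_, hcd.ne.symm⟩, hφ.1, hφ.2, fun h => hne.2.2 h.symm⟩
      · rintro rfl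
        have := hne.1 rfl
        have := hcd.ne
        tauto
      · rintro rfl
        have := hne.2.1 rfl
        have := hcd.ne
        tauto
  have h2 : #bad * (Fintype.card V - 3) ≤ Fintype.card W ^ 2 * (2 * D * extCount W V 2) := by
    calc #bad * (Fintype.card V - 3)
        ≤ (∑ p ∈ P, #{φ : W ↪ V | φ a = u ∧ φ b = v ∧ ¬G.Adj (φ p.1) (φ p.2)}) *
          (Fintype.card V - 3) := Nat.mul_le_mul_right _ card_biUnion_le
      _ ≤ ∑ p ∈ P, 2 * D * extCount W V 2 := by
          rw [sum_mul]
          refine sum_le_sum fun p hp => ?_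
          simp only [hP, mem_filter, mem_univ, true_and] at hp
          exact card_extensions_not_adj_le hab hp.1 hp.2.1 hp.2.2 hD (by omega)
      _ ≤ Fintype.card W ^ 2 * (2 * D * extCount W V 2) := by
          rw [sum_const, smul_eq_mul]
          refine Nat.mul_le_mul_right _ ((card_le_univ _).trans ?_)
          rw [Fintype.card_prod, sq]
  have h3 : 4 * #bad * (Fintype.card V - 3) ≤ extCount W V 2 * (Fintype.card V - 3) := by
    have : 8 * Fintype.card W ^ 2 * D ≤ Fintype.card V - 3 := by omega
    nlinarith [Nat.mul_le_mul_left (extCount W V 2) this]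
  have h4 : 4 * #bad ≤ extCount W V 2 := Nat.le_of_mul_le_mul_right h3 (by omega)
  omega

/-- If `K` and `G` agree up to few pairs at each vertex, and at least twice as many edges of `K` are
missing in `G` as conversely, then `K` has more copies of `H` than `G`. -/
theorem card_injHoms_add_le {H : SimpleGraph W} {G K : SimpleGraph V} (hH : H ≠ ⊥) {D : ℕ}
    (hD : ∀ x, #{y | ¬(G.Adj x y ∧ K.Adj x y)} ≤ D)
    (hn : 8 * Fintype.card W ^ 2 * D + 4 ≤ Fintype.card V)
    (hIM : 2 * #(adjPairs G \ adjPairs K) ≤ #(adjPairs K \ adjPairs G)) :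
    4 * #(injHoms H G) + extCount W V 2 * #(adjPairs K \ adjPairs G) ≤ 4 * #(injHoms H K) := by
  obtain ⟨J, hJ⟩ : ∃ J : SimpleGraph V, ∀ x y, J.Adj x y ↔ G.Adj x y ∧ K.Adj x y :=
    ⟨G ⊓ K, fun _ _ => Iff.rfl⟩
  simp only [← hJ] at hD
  set M := adjPairs K \ adjPairs G with hM
  set I := adjPairs G \ adjPairs K with hI
  set F := extCount W V 2 with hF
  obtain ⟨o, ho⟩ : ∃ o : W → ℕ, Function.Injective o :=
    ⟨fun w => (Fintype.equivFin W w : ℕ), fun x y h => by simpa [Fin.val_inj] using h⟩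
  -- `O` holds one orientation of each edge of H, so that no copy is counted twice below.
  set O : Finset (W × W) := {p | H.Adj p.1 p.2 ∧ o p.1 < o p.2} with hO
  have memO {c d : W} (h : H.Adj c d) : (c, d) ∈ O ∨ (d, c) ∈ O := by
    simp only [hO, mem_filter, mem_univ, true_and]
    rcases lt_or_gt_of_ne (ho.ne h.ne) with h' | h'
    · exact Or.inl ⟨h, h'⟩
    · exact Or.inr ⟨h.symm, h'⟩
  have hOpos : 1 ≤ #O := by
    obtain ⟨a, b, hab⟩ := SimpleGraph.ne_bot_iff_exists_adj.1 hH
    rcases memO hab with h | h <;> exact card_pos.2 ⟨_, h⟩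
  have gain : #(injHoms H G \ injHoms H K) ≤ #O * (#I * F) := by
    refine (card_le_card (t := O.biUnion fun p => {φ : W ↪ V | (φ p.1, φ p.2) ∈ I})
      fun φ hφ => ?_).trans (card_biUnion_le.trans ?_)
    · rw [mem_sdiff, mem_injHoms, mem_injHoms] at hφ
      obtain ⟨h1, h2⟩ := hφ
      push Not at h2
      obtain ⟨c, d, hcd, hK⟩ := h2
      simp only [mem_biUnion, mem_filter, mem_univ, true_and, hI, mem_sdiff, mem_adjPairs]
      rcases memO hcd with h | h
      · exact ⟨_, h, h1 _ _ hcd, hK⟩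
      · exact ⟨_, h, h1 _ _ hcd.symm, fun h => hK h.symm⟩
    · rw [← smul_eq_mul, ← sum_const]
      refine sum_le_sum fun p hp => le_of_eq (card_filter_pair_mem ?_ _ ?_)
      · simp only [hO, mem_filter] at hp
        exact hp.2.1.ne
      · intro q hq
        rw [hI, mem_sdiff, mem_adjPairs] at hq
        exact hq.1.ne
  let B (p : W × W) (q : V × V) : Finset (W ↪ V) := {φ | φ p.1 = q.1 ∧ φ p.2 = q.2 ∧
    ∀ c d, H.Adj c d → (c = p.1 ∧ d = p.2) ∨ (c = p.2 ∧ d = p.1) ∨ J.Adj (φ c) (φ d)}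
  have loss : #O * (#M * (3 * F)) ≤ 4 * #(injHoms H K \ injHoms H G) := by
    have hsub : ((O ×ˢ M).biUnion fun x => B x.1 x.2) ⊆ injHoms H K \ injHoms H G := by
      intro φ hφ
      simp only [mem_biUnion, mem_product, B, mem_filter, mem_univ, true_and] at hφ
      obtain ⟨⟨⟨a, b⟩, u, v⟩, ⟨hp, hq⟩, h1, h2, h3⟩ := hφ
      simp only [hO, hM, mem_filter, mem_univ, true_and, mem_sdiff, mem_adjPairs] at hp hq h1 h2 h3
      rw [mem_sdiff, mem_injHoms, mem_injHoms]
      refine ⟨fun c d hcd => ?_, fun h => hq.2 ?_⟩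
      · rcases h3 c d hcd with ⟨rfl, rfl⟩ | ⟨rfl, rfl⟩ | h
        · rw [h1, h2]; exact hq.1
        · rw [h1, h2]; exact hq.1.symm
        · exact ((hJ _ _).1 h).2
      · rw [← h1, ← h2]; exact h _ _ hp.1
    -- An injection in `B` sends just one edge of H outside `G`, so it determines that edge; `O`
    -- fixes its orientation.
    have hdisj : ((O ×ˢ M : Finset _) : Set ((W × W) × (V × V))).PairwiseDisjoint
        fun x => B x.1 x.2 := by
      rintro ⟨⟨a, b⟩, u, v⟩ hx ⟨⟨a', b'⟩, u', v'⟩ hy hne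
      rw [Function.onFun, Finset.disjoint_left]
      intro φ hφ hφ'
      simp only [coe_product, Set.mem_prod, mem_coe, hO, hM, mem_filter, mem_univ, true_and,
        mem_sdiff, mem_adjPairs] at hx hy
      simp only [B, mem_filter, mem_univ, true_and] at hφ hφ'
      obtain ⟨rfl, rfl, h3⟩ := hφ
      obtain ⟨rfl, rfl, h3'⟩ := hφ'
      rcases h3' a b hx.1.1 with ⟨rfl, rfl⟩ | ⟨rfl, rfl⟩ | h
      · exact hne rfl
      · exact lt_asymm hx.1.2 hy.1.2
      · exact hx.2.2 ((hJ _ _).1 h).1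
    calc #O * (#M * (3 * F)) = ∑ x ∈ O ×ˢ M, 3 * F := by
          rw [sum_const, card_product, smul_eq_mul, mul_assoc]
      _ ≤ ∑ x ∈ O ×ˢ M, 4 * #(B x.1 x.2) := by
          refine sum_le_sum fun x hx => ?_
          simp only [mem_product, hO, hM, mem_filter, mem_univ, true_and,
            mem_sdiff, mem_adjPairs] at hx
          exact three_mul_extCount_le hx.1.1.ne hx.2.1.ne hD hn
      _ = 4 * #((O ×ˢ M).biUnion fun x => B x.1 x.2) := by
          rw [card_biUnion hdisj, mul_sum]
      _ ≤ _ := Nat.mul_le_mul_left _ (card_le_card hsub)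
  have h1 := card_sdiff_add_card_inter (injHoms H G) (injHoms H K)
  have h2 := card_sdiff_add_card_inter (injHoms H K) (injHoms H G)
  rw [inter_comm] at h2
  -- As 2|I| ≤ |M|, the difference 3|M| − 4|I| is at least |M|.
  have h3 : #O * (4 * (#I * F)) + F * #M ≤ #O * (#M * (3 * F)) := by
    have : F * #M ≤ #O * (F * #M) := Nat.le_mul_of_pos_left _ hOpos
    have h5 : #O * (F * (2 * #I)) ≤ #O * (F * #M) := by gcongr
    nlinarith
  nlinarith

/-! ### Degree-majorising partitions of clique-free graphs -/

/-- Let x have maximum degree in A and neighbourhood B there. The part with label 0 is A \ B, and B,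
having no clique of one order less, is partitioned by induction. A vertex v of A \ B has at most |B|
neighbours in A, so its neighbours in A \ B are no more than its non-neighbours in B. -/
theorem exists_partition_on {V : Type*} (G : SimpleGraph V) (r : ℕ) : ∀ A : Finset V,
    (∀ s ⊆ A, ¬G.IsNClique (r + 1) s) → ∃ f : V → ℕ, (∀ v ∈ A, f v < r) ∧
      ∀ v ∈ A, #{w ∈ A | f w = f v ∧ G.Adj v w} ≤ #{w ∈ A | f v < f w ∧ ¬G.Adj v w} := by
  induction r with
  | zero =>
    intro A hA
    have : A = ∅ := by
      rw [eq_empty_iff_forall_notMem]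
      intro v hv
      exact hA {v} (by simpa using hv) (by simp [SimpleGraph.isNClique_iff])
    exact ⟨fun _ => 0, by simp [this], by simp [this]⟩
  | succ r ih =>
    intro A hA
    rcases A.eq_empty_or_nonempty with rfl | hne
    · exact ⟨fun _ => 0, by simp, by simp⟩
    obtain ⟨x, hx, hmax⟩ := exists_max_image A (fun v => #{w ∈ A | G.Adj v w}) hne
    set B : Finset V := {w ∈ A | G.Adj x w} with hB
    obtain ⟨f, hf, hfB⟩ := ih B fun s hs hcl => by
      refine hA (insert x s) ?_ (hcl.insert fun b hb => ?_)
      · exact insert_subset hx (hs.trans (filter_subset _ _))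
      · exact (mem_filter.1 (hs hb)).2
    refine ⟨fun v => if v ∈ B then f v + 1 else 0, fun v _ => ?_, fun v hv => ?_⟩
    · by_cases h : v ∈ B
      · simpa [h] using hf v h
      · simp [h]
    · by_cases h : v ∈ B
      · refine le_trans (card_le_card fun w hw => ?_) ((hfB v h).trans (card_le_card fun w hw => ?_))
        · simp only [mem_filter, h, if_true] at hw ⊢
          by_cases hwB : w ∈ B
          · simp only [hwB, if_true] at hw
            exact ⟨hwB, by omega, hw.2.2⟩
          · simp [hwB] at hw
        · simp only [mem_filter, h, if_true] at hw ⊢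
          simp only [hw.1, if_true]
          exact ⟨(mem_filter.1 hw.1).1, by omega, hw.2.2⟩
      · have h1 : #{w ∈ A | (if w ∈ B then f w + 1 else 0) = (if v ∈ B then f v + 1 else 0) ∧
            G.Adj v w} ≤ #{w ∈ A \ B | G.Adj v w} := by
          refine card_le_card fun w hw => ?_
          simp only [mem_filter, h, if_false, mem_sdiff] at hw ⊢
          by_cases hwB : w ∈ B
          · simp [hwB] at hw
          · exact ⟨⟨hw.1, hwB⟩, hw.2.2⟩
        have h2 : #{w ∈ B | ¬G.Adj v w} ≤ #{w ∈ A | (if v ∈ B then f v + 1 else 0) <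
            (if w ∈ B then f w + 1 else 0) ∧ ¬G.Adj v w} := by
          refine card_le_card fun w hw => ?_
          simp only [mem_filter, h, if_false] at hw ⊢
          simp only [hw.1, if_true]
          exact ⟨(mem_filter.1 hw.1).1, by omega, hw.2⟩
        have h3 : #{w ∈ A | G.Adj v w} = #{w ∈ A \ B | G.Adj v w} + #{w ∈ B | G.Adj v w} := by
          rw [← card_union_of_disjoint, ← filter_union,
            sdiff_union_of_subset (filter_subset _ _)]
          exact disjoint_filter_filter sdiff_disjoint
        have h4 := card_filter_add_card_filter_not (s := B) fun w => G.Adj v w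
        have h5 := hmax v hv
        refine h1.trans (le_trans ?_ h2)
        omega

/-- A `K_{r+1}`-free graph has an `r`-partition in which every vertex has at most as many
neighbours inside its own part as non-neighbours in the later parts. -/
theorem exists_partition {G : SimpleGraph V} {r : ℕ} (hG : G.CliqueFree (r + 1)) :
    ∃ f : V → ℕ, (∀ v, f v < r) ∧
      ∀ v, #{w | f w = f v ∧ G.Adj v w} ≤ #{w | f v < f w ∧ ¬G.Adj v w} := by
  obtain ⟨f, h1, h2⟩ := exists_partition_on G r univ fun s _ => hG s
  exact ⟨f, fun v => h1 v (mem_univ v), fun v => h2 v (mem_univ v)⟩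

theorem card_filter_prod (p : V → V → Prop) [∀ v w, Decidable (p v w)] :
    #{x : V × V | p x.1 x.2} = ∑ v, #{w | p v w} := by
  rw [card_filter, Fintype.sum_prod_type]
  exact sum_congr rfl fun v _ => (card_filter _ _).symm

/-- Summing the hypothesis over v counts the pairs inside parts in both orders, but the missing
pairs only in the order towards the later part. Reversal supplies the factor 2. -/
theorem two_mul_card_adjPairs_sdiff_le {G : SimpleGraph V} {f : V → ℕ}
    (hf : ∀ v, #{w | f w = f v ∧ G.Adj v w} ≤ #{w | f v < f w ∧ ¬G.Adj v w}) :
    2 * #(adjPairs G \ adjPairs (multipartite f)) ≤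
      #(adjPairs (multipartite f) \ adjPairs G) := by
  have h1 : #(adjPairs G \ adjPairs (multipartite f)) ≤
      #{x : V × V | f x.1 < f x.2 ∧ ¬G.Adj x.1 x.2} := by
    rw [card_filter_prod fun v w => f v < f w ∧ ¬G.Adj v w]
    refine le_trans ?_ (sum_le_sum fun v _ => hf v)
    rw [← card_filter_prod fun v w => f w = f v ∧ G.Adj v w]
    refine card_le_card fun x hx => ?_
    simp only [mem_sdiff, mem_adjPairs, multipartite_adj, not_not] at hx
    simpa using ⟨hx.2.symm, hx.1⟩
  have h2 : #{x : V × V | f x.1 < f x.2 ∧ ¬G.Adj x.1 x.2} =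
      #{x : V × V | f x.2 < f x.1 ∧ ¬G.Adj x.1 x.2} :=
    card_bij (fun x _ => x.swap) (by simp [SimpleGraph.adj_comm]) (by simp)
      (fun x hx => ⟨x.swap, by simpa [SimpleGraph.adj_comm] using hx, by simp⟩)
  have h3 : #{x : V × V | f x.1 < f x.2 ∧ ¬G.Adj x.1 x.2} +
      #{x : V × V | f x.2 < f x.1 ∧ ¬G.Adj x.1 x.2} ≤
      #(adjPairs (multipartite f) \ adjPairs G) := by
    rw [← card_union_of_disjoint]
    · refine card_le_card fun x hx => ?_
      simp only [mem_union, mem_filter, mem_univ, true_and] at hx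
      simp only [mem_sdiff, mem_adjPairs, multipartite_adj]
      rcases hx with h | h
      · exact ⟨h.1.ne, h.2⟩
      · exact ⟨h.1.ne', h.2⟩
    · rw [disjoint_left]
      intro x hx hy
      simp only [mem_filter, mem_univ, true_and] at hx hy
      exact lt_asymm hx.1 hy.1
  omega

/-! ### Complete multipartite graphs and their part sizes -/

theorem multipartite_cliqueFree {V : Type*} {f : V → ℕ} {r : ℕ} (hf : ∀ v, f v < r) :
    (multipartite f).CliqueFree (r + 1) := by
  have : (multipartite f).Colorable r :=
    ⟨SimpleGraph.Coloring.mk (fun v => (⟨f v, hf v⟩ : Fin r)) fun {v w} h h' =>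
      h (by simpa using h')⟩
  exact this.cliqueFree (Nat.lt_succ_self r)

theorem sum_card_fiber {f : V → ℕ} {r : ℕ} (hf : ∀ v, f v < r) :
    ∑ k ∈ range r, #{v | f v = k} = Fintype.card V :=
  (card_eq_sum_card_fiberwise fun v _ => by simpa using hf v).symm

theorem card_adjPairs_multipartite {f : V → ℕ} {r : ℕ} (hf : ∀ v, f v < r) :
    #(adjPairs (multipartite f)) + ∑ k ∈ range r, #{v | f v = k} ^ 2 = Fintype.card V ^ 2 := by
  have h1 : ∑ k ∈ range r, #{v | f v = k} ^ 2 = #{x : V × V | f x.2 = f x.1} := by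
    rw [card_filter_prod fun v w => f w = f v,
      ← sum_fiberwise_of_maps_to (g := f) (t := range r) (fun v _ => by simpa using hf v)]
    refine sum_congr rfl fun k _ => ?_
    rw [sum_congr rfl (g := fun _ => #{v | f v = k}), sum_const, smul_eq_mul, sq]
    intro v hv
    rw [(mem_filter.1 hv).2]
  rw [h1, sq, ← Fintype.card_prod]
  have h2 := card_filter_add_card_filter_not (s := univ) fun x : V × V => f x.2 = f x.1
  rw [card_univ] at h2
  rw [← h2, add_comm]
  congr 2
  ext x
  simp [mem_adjPairs, eq_comm]

theorem card_fiber_update {f : V → ℕ} {u : V} {j : ℕ} (h : f u ≠ j) (k : ℕ) :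
    (#{v | Function.update f u j v = k} : ℤ) =
      #{v | f v = k} + (if k = j then 1 else 0) - (if k = f u then 1 else 0) := by
  by_cases h1 : k = j
  · subst h1
    have : univ.filter (fun v => Function.update f u k v = k) =
        insert u (univ.filter fun v => f v = k) := by
      ext v
      by_cases hv : v = u <;> simp [hv, Function.update_apply]
    rw [this, card_insert_of_notMem (by simpa using h)]
    simp [h.symm]
  · by_cases h2 : k = f u
    · subst h2
      have : univ.filter (fun v => f v = f u) =
          insert u (univ.filter fun v => Function.update f u j v = f u) := by
        ext v
        by_cases hv : v = u <;> simp [hv, Function.update_apply]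
      rw [this, card_insert_of_notMem (by simpa [Function.update_apply] using h.symm)]
      simp [h1]
    · have : univ.filter (fun v => Function.update f u j v = k) =
          univ.filter fun v => f v = k := by
        ext v
        by_cases hv : v = u
        · subst hv; simp [Function.update_apply, h1, h2, eq_comm]
        · simp [hv, Function.update_apply]
      rw [this]
      simp [h1, h2]

theorem exists_equiv_of_card_fiber_eq {ι : Type*} [DecidableEq ι] {f g : V → ι}
    (h : ∀ k, #{v | f v = k} = #{v | g v = k}) : ∃ e : V ≃ V, ∀ v, g (e v) = f v := by
  have key (k : ι) : Nonempty ({v // f v = k} ≃ {v // g v = k}) := by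
    rw [← Fintype.card_eq, Fintype.card_subtype, Fintype.card_subtype]
    exact h k
  let e' : V ≃ V := (Equiv.sigmaFiberEquiv f).symm.trans
    ((Equiv.sigmaCongrRight fun k => (key k).some).trans (Equiv.sigmaFiberEquiv g))
  exact ⟨e', fun v => ((key (f v)).some ⟨v, rfl⟩).2⟩

/-! ### Cloning a vertex -/

/-- Replacing `u` by a copy of `w` changes the number of copies of `H` by the difference of the
numbers of copies through `w` and through `u`, up to the copies through both. -/
theorem card_injHoms_replaceVertex (H : SimpleGraph W) (G : SimpleGraph V) {u w : V} (huw : u ≠ w) :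
    #(injHoms H G) + #{φ ∈ injHoms H G | ∃ a, φ a = w} ≤
      #(injHoms H (G.replaceVertex w u)) + #{φ ∈ injHoms H G | ∃ a, φ a = u} +
        Fintype.card W ^ 2 * extCount W V 2 := by
  set A : Finset (W ↪ V) := {φ ∈ injHoms H G | ¬∃ a, φ a = u} with hA
  set B : Finset (W ↪ V) := {φ ∈ injHoms H G | (∃ a, φ a = w) ∧ ¬∃ a, φ a = u} with hB
  set C : Finset (W ↪ V) := {φ ∈ injHoms H G | (∃ a, φ a = w) ∧ ∃ a, φ a = u} with hC
  have h1 := card_filter_add_card_filter_not (s := injHoms H G) fun φ => ∃ a, φ a = u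
  have h2 : #{φ ∈ injHoms H G | ∃ a, φ a = w} = #B + #C := by
    rw [← card_filter_add_card_filter_not (s := {φ ∈ injHoms H G | ∃ a, φ a = w})
      fun φ => ∃ a, φ a = u, filter_filter, filter_filter, add_comm]
  have h3 : #C ≤ Fintype.card W ^ 2 * extCount W V 2 := by
    have : C ⊆ (univ : Finset (W × W)).biUnion fun p => {φ : W ↪ V | φ p.1 = w ∧ φ p.2 = u} := by
      intro φ hφ
      simp only [hC, mem_filter] at hφ
      obtain ⟨-, ⟨a, ha⟩, b, hb⟩ := hφ
      simp only [mem_biUnion, mem_filter, mem_univ, true_and]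
      exact ⟨(a, b), ha, hb⟩
    refine (card_le_card this).trans (card_biUnion_le.trans ?_)
    refine (sum_le_card_nsmul _ _ (extCount W V 2) fun p _ => ?_).trans ?_
    · by_cases hp : p.1 = p.2
      · rw [filter_eq_empty_iff.2]
        · simp
        · rintro φ - ⟨h, h'⟩
          rw [hp] at h
          exact huw (h'.symm.trans h)
      · exact (card_extensions_two hp huw.symm).le
    · rw [card_univ, Fintype.card_prod, sq, smul_eq_mul]
  -- Homomorphisms avoiding u survive. Those through w but not u yield new ones through the clone,
  -- by swapping u and w.
  have h4 : #A + #B ≤ #(injHoms H (G.replaceVertex w u)) := by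
    have inj : Function.Injective fun φ : W ↪ V => φ.trans (Equiv.swap u w).toEmbedding := by
      intro φ ψ h
      ext a
      exact (Equiv.swap u w).injective (DFunLike.congr_fun h a)
    rw [← card_image_of_injective B inj, ← card_union_of_disjoint]
    · refine card_le_card (union_subset (fun φ hφ => ?_) fun φ hφ => ?_)
      · rw [hA, mem_filter, mem_injHoms] at hφ
        obtain ⟨h, hu⟩ := hφ
        push Not at hu
        exact mem_injHoms.2 fun a b hab =>
          (G.adj_replaceVertex_iff_of_ne _ (hu a) (hu b)).2 (h a b hab)
      · obtain ⟨ψ, hψ, rfl⟩ := mem_image.1 hφ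
        rw [hB, mem_filter, mem_injHoms] at hψ
        obtain ⟨h, -, hu⟩ := hψ
        push Not at hu
        refine mem_injHoms.2 fun a b hab => ?_
        have hne : ψ a ≠ ψ b := ψ.injective.ne hab.ne
        simp only [Function.Embedding.trans_apply, Equiv.coe_toEmbedding]
        by_cases ha : ψ a = w
        · have hb : ψ b ≠ w := fun hb => hne (ha.trans hb.symm)
          rw [ha, Equiv.swap_apply_right, Equiv.swap_apply_of_ne_of_ne (hu b) hb,
            G.adj_replaceVertex_iff_of_ne_right _ (hu b), ← ha]
          exact h a b hab
        · by_cases hb : ψ b = w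
          · rw [hb, Equiv.swap_apply_right, Equiv.swap_apply_of_ne_of_ne (hu a) ha,
              SimpleGraph.adj_comm, G.adj_replaceVertex_iff_of_ne_right _ (hu a), ← hb]
            exact (h a b hab).symm
          · rw [Equiv.swap_apply_of_ne_of_ne (hu a) ha, Equiv.swap_apply_of_ne_of_ne (hu b) hb]
            exact (G.adj_replaceVertex_iff_of_ne _ (hu a) (hu b)).2 (h a b hab)
    · rw [disjoint_left]
      intro φ hφ hφ'
      obtain ⟨ψ, hψ, rfl⟩ := mem_image.1 hφ'
      rw [hB, mem_filter] at hψ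
      obtain ⟨-, ⟨a, ha⟩, -⟩ := hψ
      rw [hA, mem_filter] at hφ
      refine hφ.2 ⟨a, ?_⟩
      simp [ha]
  rw [← h1, h2]
  linarith

/-! ### Moving a vertex to a smaller part -/

theorem card_fiber_update_le {f : V → ℕ} {u : V} {j D : ℕ} (hD : ∀ k, #{v | f v = k} ≤ D)
    (hlt : #{v | f v = j} < #{v | f v = f u}) (k : ℕ) :
    #{v | Function.update f u j v = k} ≤ D := by
  have hne : f u ≠ j := by rintro h; rw [h] at hlt; exact lt_irrefl _ hlt
  have h := card_fiber_update hne k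
  have h1 := hD k
  have h2 := hD (f u)
  by_cases hk : k = j
  · subst hk
    simp only [if_true, if_neg hne.symm] at h
    omega
  · rw [if_neg hk] at h
    split_ifs at h <;> omega

theorem card_fiber_not_mem {c : V → ℕ} {X : Finset V} {m : ℕ} (hX : ∀ v ∈ X, c v = m) (k : ℕ) :
    #{v | v ∉ X ∧ c v = k} + (if k = m then #X else 0) = #{v | c v = k} := by
  have h := card_filter_add_card_filter_not (s := {v | c v = k}) fun v => v ∈ X
  rw [filter_filter, filter_filter] at h
  rw [← h, add_comm]
  congr 1
  · split_ifs with hk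
    · congr 1
      ext v
      simp only [mem_filter, mem_univ, true_and]
      exact ⟨fun hv => ⟨(hX v hv).trans hk.symm, hv⟩, fun hv => hv.2⟩
    · symm
      rw [card_eq_zero, filter_eq_empty_iff]
      rintro v - ⟨h1, h2⟩
      exact hk (h1.symm.trans (hX v h2))
  · congr 1
    ext v
    simp [and_comm]

/-- Moving a vertex `u` from its part to a smaller part does not change the multipartite graph, up to
isomorphism, outside a set `X` of vertices of the larger part that makes up for the difference. -/
theorem exists_equiv_move {f : V → ℕ} {u : V} {j : ℕ} (hj : f u ≠ j) {X : Finset V}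
    (hX : ∀ v ∈ X, f v = f u) (huX : u ∉ X)
    (hcard : #X + #{v | f v = j} + 1 = #{v | f v = f u}) :
    ∃ σ : V ≃ V, ∀ v ∉ X, σ v ∉ X ∧
      Equiv.swap (f u) j (Function.update f u j (σ v)) = f v := by
  have hX' : ∀ v ∈ X, Function.update f u j v = f u := by
    intro v hv
    have : v ≠ u := by rintro rfl; exact huX hv
    rw [Function.update_of_ne this, hX v hv]
  -- Outside X, the two parts have sizes q + 1 and q before the move and q and q + 1 after it, with
  -- q the size of part `j`; swapping the labels matches them. The value `none` keeps X apart.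
  obtain ⟨σ, hσ⟩ := exists_equiv_of_card_fiber_eq
    (f := fun v => if v ∈ X then none else some (f v))
    (g := fun v => if v ∈ X then none else
      some (Equiv.swap (f u) j (Function.update f u j v))) (by
    intro k
    cases k with
    | none => simp
    | some k =>
      have e1 : univ.filter (fun v => (if v ∈ X then none else some (f v)) = some k) =
          univ.filter fun v => v ∉ X ∧ f v = k := by
        ext v; by_cases h : v ∈ X <;> simp [h]
      have e2 : univ.filter (fun v => (if v ∈ X then none else
          some (Equiv.swap (f u) j (Function.update f u j v))) = some k) =
          univ.filter fun v => v ∉ X ∧ Function.update f u j v = Equiv.swap (f u) j k := by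
        ext v
        by_cases h : v ∈ X
        · simp [h]
        · simp [h, Equiv.swap_apply_eq_iff]
      rw [e1, e2]
      have h1 := card_fiber_not_mem hX k
      have h2 := card_fiber_not_mem hX' (Equiv.swap (f u) j k)
      have h3 := card_fiber_update hj (Equiv.swap (f u) j k)
      by_cases hk : k = f u
      · subst hk
        rw [Equiv.swap_apply_left] at *
        simp only [if_true, if_neg hj.symm] at h1 h2 h3
        omega
      · by_cases hk' : k = j
        · subst hk'
          rw [Equiv.swap_apply_right] at *
          simp only [if_true, if_neg hj, if_neg hj.symm] at h1 h2 h3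
          omega
        · rw [Equiv.swap_apply_of_ne_of_ne hk hk'] at *
          simp only [if_neg hk, if_neg hk'] at h1 h2 h3
          omega)
  refine ⟨σ, fun v hv => ?_⟩
  have h := hσ v
  by_cases h' : σ v ∈ X
  · simp [h', hv] at h
  · simp only [if_neg h', if_neg hv, Option.some.injEq] at h
    exact ⟨h', h⟩

theorem card_three_constraints_le {c d e : W} (hcd : c ≠ d) (hce : c ≠ e) (hde : d ≠ e) (u : V)
    (Q X : Finset V) (hn : 2 < Fintype.card V) :
    #{φ : W ↪ V | φ c = u ∧ φ d ∈ Q ∧ φ e ∈ X} * (Fintype.card V - 2) ≤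
      #Q * #X * extCount W V 2 := by
  have h3 : 3 ≤ Fintype.card W := Fintype.two_lt_card_iff.2 ⟨c, d, e, hcd, hce, hde⟩
  have e2 : extCount W V 2 = (Fintype.card V - 2) * extCount W V 3 :=
    extCount_succ (by omega) (by omega)
  have : #{φ : W ↪ V | φ c = u ∧ φ d ∈ Q ∧ φ e ∈ X} ≤ #(Q ×ˢ X) * extCount W V 3 := by
    refine (card_le_card (t := (Q ×ˢ X).biUnion fun p =>
      {φ : W ↪ V | φ c = u ∧ φ d = p.1 ∧ φ e = p.2}) fun φ hφ => ?_).trans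
      (card_biUnion_le.trans (sum_le_card_nsmul _ _ _ fun p _ =>
        card_extensions_three_le u p.1 p.2 hcd hce hde))
    simp only [mem_filter, mem_univ, true_and, mem_biUnion, mem_product] at hφ ⊢
    exact ⟨(φ d, φ e), hφ.2, hφ.1, rfl, rfl⟩
  rw [card_product] at this
  calc _ ≤ #Q * #X * extCount W V 3 * (Fintype.card V - 2) := Nat.mul_le_mul_right _ this
    _ = _ := by rw [e2]; ring

/-- A homomorphism destroyed by the move sends an edge of H to u and a vertex of part `j`. Meeting X
constrains a third vertex of H, distinct from both ends because X avoids u and part `j`. Small parts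
therefore make this loss a small fraction of |X|·`extCount W V 2`. -/
theorem card_injHoms_sdiff_move_le {H : SimpleGraph W} {f : V → ℕ} {u : V} {j : ℕ}
    (hj : f u ≠ j) {X : Finset V} (hX : ∀ v ∈ X, f v = f u) (huX : u ∉ X)
    (hn : 2 < Fintype.card V) :
    #{φ ∈ injHoms H (multipartite f) \ injHoms H (multipartite (Function.update f u j)) |
      ∃ e, φ e ∈ X} * (Fintype.card V - 2) ≤
      Fintype.card W ^ 3 * (#{v | f v = j} * #X * extCount W V 2) := by
  set Q : Finset V := {v | f v = j} with hQ
  set T : Finset (W × W × W) := {t | t.1 ≠ t.2.1 ∧ t.1 ≠ t.2.2 ∧ t.2.1 ≠ t.2.2} with hT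
  have hsub : {φ ∈ injHoms H (multipartite f) \
      injHoms H (multipartite (Function.update f u j)) | ∃ e, φ e ∈ X} ⊆
      T.biUnion fun t => {φ : W ↪ V | φ t.1 = u ∧ φ t.2.1 ∈ Q ∧ φ t.2.2 ∈ X} := by
    intro φ hφ
    simp only [mem_filter, mem_sdiff, mem_injHoms, multipartite_adj] at hφ
    obtain ⟨⟨h1, h2⟩, e, he⟩ := hφ
    push Not at h2
    obtain ⟨c, d, hcd, h3⟩ := h2
    have main (c d : W) (hcd : H.Adj c d)
        (h3 : Function.update f u j (φ c) = Function.update f u j (φ d)) (hc : φ c = u) :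
        φ ∈ T.biUnion fun t => {φ : W ↪ V | φ t.1 = u ∧ φ t.2.1 ∈ Q ∧ φ t.2.2 ∈ X} := by
      have hd : φ d ≠ u := fun h => hcd.ne (φ.injective (hc.trans h.symm))
      rw [hc, Function.update_self, Function.update_of_ne hd] at h3
      have hdQ : φ d ∈ Q := by simpa [hQ] using h3.symm
      simp only [mem_biUnion, hT, mem_filter, mem_univ, true_and]
      refine ⟨(c, d, e), ⟨hcd.ne, ?_, ?_⟩, hc, hdQ, he⟩
      · intro (h : c = e)
        exact huX (hc ▸ h ▸ he)
      · intro (h : d = e)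
        exact hj ((hX _ (h ▸ he)).symm.trans h3.symm)
    by_cases hc : φ c = u
    · exact main c d hcd h3 hc
    · by_cases hd : φ d = u
      · exact main d c hcd.symm h3.symm hd
      · rw [Function.update_of_ne hc, Function.update_of_ne hd] at h3
        exact absurd h3 (h1 c d hcd)
  calc _ ≤ (∑ t ∈ T, #{φ : W ↪ V | φ t.1 = u ∧ φ t.2.1 ∈ Q ∧ φ t.2.2 ∈ X}) *
        (Fintype.card V - 2) :=
        Nat.mul_le_mul_right _ ((card_le_card hsub).trans card_biUnion_le)
    _ ≤ ∑ t ∈ T, #Q * #X * extCount W V 2 := by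
        rw [sum_mul]
        refine sum_le_sum fun t ht => ?_
        simp only [hT, mem_filter, mem_univ, true_and] at ht
        exact card_three_constraints_le ht.1 ht.2.1 ht.2.2 u Q X hn
    _ ≤ _ := by
        rw [sum_const, smul_eq_mul]
        refine Nat.mul_le_mul_right _ ((card_le_univ _).trans ?_)
        rw [Fintype.card_prod, Fintype.card_prod]
        exact le_of_eq (by ring)

/-- The move makes u adjacent to every x in X. Each new edge ux carries at least 3/4 of the
injections sending ab to it, and the value at `b` tells these families apart. -/
theorem le_card_injHoms_sdiff_move {H : SimpleGraph W} {a b : W} (hab : H.Adj a b) {f : V → ℕ}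
    {u : V} {j D : ℕ} (hD : ∀ k, #{v | f v = k} ≤ D)
    (hlt : #{v | f v = j} < #{v | f v = f u}) {X : Finset V} (hX : ∀ v ∈ X, f v = f u)
    (huX : u ∉ X) (hn : 8 * Fintype.card W ^ 2 * D + 4 ≤ Fintype.card V) :
    3 * (#X * extCount W V 2) ≤ 4 * #{φ ∈ injHoms H (multipartite (Function.update f u j)) \
      injHoms H (multipartite f) | ∃ e, φ e ∈ X} := by
  have hj : f u ≠ j := by rintro h; rw [h] at hlt; exact lt_irrefl _ hlt
  set f' := Function.update f u j with hf'
  let B (x : V) : Finset (W ↪ V) := {φ | φ a = u ∧ φ b = x ∧ ∀ c d, H.Adj c d →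
      (c = a ∧ d = b) ∨ (c = b ∧ d = a) ∨ (multipartite f').Adj (φ c) (φ d)}
  have hux {x : V} (hx : x ∈ X) : u ≠ x := by rintro rfl; exact huX hx
  have hsub : X.biUnion B ⊆ {φ ∈ injHoms H (multipartite f') \
      injHoms H (multipartite f) | ∃ e, φ e ∈ X} := by
    intro φ hφ
    simp only [mem_biUnion, B, mem_filter, mem_univ, true_and] at hφ
    obtain ⟨x, hx, h1, h2, h3⟩ := hφ
    have hadj : f' (φ a) ≠ f' (φ b) := by
      rw [h1, h2, hf', Function.update_self, Function.update_of_ne (hux hx).symm, hX x hx]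
      exact hj.symm
    simp only [mem_filter, mem_sdiff, mem_injHoms]
    refine ⟨⟨fun c d hcd => ?_, fun h => ?_⟩, b, h2 ▸ hx⟩
    · rcases h3 c d hcd with ⟨rfl, rfl⟩ | ⟨rfl, rfl⟩ | h
      · exact hadj
      · exact hadj.symm
      · exact h
    · refine h a b hab ?_
      rw [h1, h2, hX x hx]
  have hdisj : (X : Set V).PairwiseDisjoint B := by
    intro x _ y _ hne
    rw [Function.onFun, disjoint_left]
    intro φ hφ hφ'
    simp only [B, mem_filter, mem_univ, true_and] at hφ hφ'
    exact hne (hφ.2.1.symm.trans hφ'.2.1)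
  have hD' : ∀ x, #{y | ¬(multipartite f').Adj x y} ≤ D := by
    intro x
    refine le_trans (card_le_card fun y hy => ?_) (card_fiber_update_le hD hlt (f' x))
    simp only [mem_filter, mem_univ, true_and, multipartite_adj, not_not] at hy ⊢
    exact hy.symm
  calc 3 * (#X * extCount W V 2) = ∑ x ∈ X, 3 * extCount W V 2 := by
        rw [sum_const, smul_eq_mul]; ring
    _ ≤ ∑ x ∈ X, 4 * #(B x) := sum_le_sum fun x hx =>
        three_mul_extCount_le hab.ne (hux hx) hD' hn
    _ = 4 * #(X.biUnion B) := by rw [card_biUnion hdisj, mul_sum]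
    _ ≤ _ := Nat.mul_le_mul_left _ (card_le_card hsub)

theorem filter_sdiff_filter {α : Type*} [DecidableEq α] (s t : Finset α) (p : α → Prop)
    [DecidablePred p] :
    {x ∈ s \ t | p x} = {x ∈ s | p x} \ {x ∈ t | p x} := by
  ext x
  simp only [mem_sdiff, mem_filter]
  tauto

/-- Moving a vertex from a part to another one that is smaller by at least two increases the number
of copies of `H` in a complete multipartite graph with small parts. -/
theorem card_injHoms_move {H : SimpleGraph W} (hH : H ≠ ⊥) {f : V → ℕ}
    {u : V} {j D x : ℕ} (hD : ∀ k, #{v | f v = k} ≤ D)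
    (hx : x + #{v | f v = j} + 1 = #{v | f v = f u})
    (hn : 4 * Fintype.card W ^ 3 * D + 4 ≤ Fintype.card V) :
    2 * #(injHoms H (multipartite f)) + x * extCount W V 2 ≤
      2 * #(injHoms H (multipartite (Function.update f u j))) := by
  obtain ⟨a, b, hab⟩ := SimpleGraph.ne_bot_iff_exists_adj.1 hH
  have hlt : #{v | f v = j} < #{v | f v = f u} := by omega
  have hj : f u ≠ j := by rintro h; rw [h] at hlt; exact lt_irrefl _ hlt
  obtain ⟨X, hXP, rfl⟩ : ∃ X ⊆ ({v | f v = f u} : Finset V).erase u, #X = x := by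
    refine exists_subset_card_eq ?_
    rw [card_erase_of_mem (by simp)]
    omega
  have hX : ∀ v ∈ X, f v = f u := fun v hv => by
    simpa using (mem_erase.1 (hXP hv)).2
  have huX : u ∉ X := fun hu => (mem_erase.1 (hXP hu)).1 rfl
  have h2 := two_le_card_of_ne hab.ne
  have hn' : 8 * Fintype.card W ^ 2 * D + 4 ≤ Fintype.card V := by
    refine le_trans ?_ hn
    have : 8 * Fintype.card W ^ 2 ≤ 4 * Fintype.card W ^ 3 := by
      rw [pow_succ _ 2]; nlinarith [sq_nonneg (Fintype.card W)]
    exact Nat.add_le_add_right (Nat.mul_le_mul_right _ this) _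
  set A := injHoms H (multipartite f) with hA
  set B := injHoms H (multipartite (Function.update f u j)) with hB
  have gain := le_card_injHoms_sdiff_move hab hD hlt hX huX hn'
  have loss := card_injHoms_sdiff_move_le (H := H) hj hX huX (by omega)
  rw [← hA, ← hB] at gain loss
  obtain ⟨σ, hσ⟩ := exists_equiv_move hj hX huX hx
  -- Homomorphisms avoiding X transfer injectively along σ, so only those meeting X matter: a gain
  -- of at least 3/4 against a loss of at most 1/4, in units of |X|·`extCount W V 2`.
  have avoid : #{φ ∈ A | ¬∃ e, φ e ∈ X} ≤ #{φ ∈ B | ¬∃ e, φ e ∈ X} := by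
    refine card_le_card_of_injOn (fun φ => φ.trans σ.toEmbedding) (fun φ hφ => ?_) ?_
    · simp only [coe_filter, Set.mem_ofPred_eq, hA, hB, mem_injHoms, multipartite_adj] at hφ ⊢
      obtain ⟨h1, h3⟩ := hφ
      push Not at h3 ⊢
      refine ⟨fun c d hcd h => h1 c d hcd ?_, fun e => (hσ _ (h3 e)).1⟩
      rw [← (hσ _ (h3 c)).2, ← (hσ _ (h3 d)).2]
      exact congrArg _ h
    · intro φ _ ψ _ h
      ext e
      exact σ.injective (DFunLike.congr_fun h e)
  have hA1 := card_filter_add_card_filter_not (s := A) fun φ => ∃ e, φ e ∈ X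
  have hB1 := card_filter_add_card_filter_not (s := B) fun φ => ∃ e, φ e ∈ X
  have hA2 := card_sdiff_add_card_inter {φ ∈ A | ∃ e, φ e ∈ X} {φ ∈ B | ∃ e, φ e ∈ X}
  have hB2 := card_sdiff_add_card_inter {φ ∈ B | ∃ e, φ e ∈ X} {φ ∈ A | ∃ e, φ e ∈ X}
  rw [inter_comm] at hB2
  rw [← filter_sdiff_filter] at hA2
  rw [← filter_sdiff_filter] at hB2
  have loss' : 4 * #{φ ∈ A \ B | ∃ e, φ e ∈ X} ≤ #X * extCount W V 2 := by
    refine Nat.le_of_mul_le_mul_right (c := Fintype.card V - 2) ?_ (by omega)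
    have hQ := hD j
    calc 4 * #{φ ∈ A \ B | ∃ e, φ e ∈ X} * (Fintype.card V - 2)
        ≤ 4 * (Fintype.card W ^ 3 * (#{v | f v = j} * #X * extCount W V 2)) := by
          linarith only [loss]
      _ ≤ 4 * (Fintype.card W ^ 3 * (D * #X * extCount W V 2)) := by gcongr
      _ = #X * extCount W V 2 * (4 * Fintype.card W ^ 3 * D) := by ring
      _ ≤ _ := Nat.mul_le_mul_left _ (by omega)
  omega

/-! ### The Turán graph -/

theorem card_adjPairs_eq_two_mul (G : SimpleGraph V) [DecidableRel G.Adj] :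
    #(adjPairs G) = 2 * #G.edgeFinset := by
  have h : adjPairs G = univ.filter fun x : V × V => G.Adj x.1 x.2 := by
    ext x
    simp [mem_adjPairs]
  rw [← G.sum_degrees_eq_twice_card_edges, h, card_filter_prod fun v w => G.Adj v w]
  refine sum_congr rfl fun v _ => ?_
  rw [← G.card_neighborFinset_eq_degree]
  congr 1
  ext w
  simp

theorem card_adjPairs_le_turanGraph {n r : ℕ} (hr : 0 < r) {G : SimpleGraph (Fin n)}
    (hG : G.CliqueFree (r + 1)) : #(adjPairs G) ≤ #(adjPairs (SimpleGraph.turanGraph n r)) := by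
  rw [card_adjPairs_eq_two_mul, card_adjPairs_eq_two_mul]
  exact Nat.mul_le_mul_left _ ((SimpleGraph.isTuranMaximal_turanGraph hr).2 hG)

theorem nonempty_iso_turanGraph {n r : ℕ} (hr : 0 < r) {G : SimpleGraph (Fin n)}
    (hG : G.CliqueFree (r + 1)) (h : #(adjPairs (SimpleGraph.turanGraph n r)) ≤ #(adjPairs G)) :
    Nonempty (G ≃g SimpleGraph.turanGraph n r) := by
  rw [card_adjPairs_eq_two_mul, card_adjPairs_eq_two_mul] at h
  have h1 : G.IsTuranMaximal r := ⟨hG, fun {G'} _ hG' =>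
    ((SimpleGraph.isTuranMaximal_turanGraph (n := n) hr).2 hG').trans (by omega)⟩
  have h2 := h1.nonempty_iso_turanGraph
  rwa [Fintype.card_fin] at h2

theorem card_injHoms_le_of_iso {V' : Type*} [Fintype V'] (H : SimpleGraph W) {G : SimpleGraph V}
    {G' : SimpleGraph V'} (e : G ≃g G') : #(injHoms H G) ≤ #(injHoms H G') := by
  refine card_le_card_of_injOn (fun φ => φ.trans e.toEquiv.toEmbedding) (fun φ hφ => ?_) ?_
  · rw [mem_coe, mem_injHoms] at hφ ⊢
    exact fun a b hab => e.map_rel_iff.2 (hφ a b hab)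
  · intro φ _ ψ _ h
    ext a
    exact e.injective (DFunLike.congr_fun h a)

theorem turanGraph_eq_multipartite (n r : ℕ) :
    SimpleGraph.turanGraph n r = multipartite fun v : Fin n => (v : ℕ) % r := rfl

theorem card_fiber_mod {n r k : ℕ} (hk : k < r) :
    n / r ≤ #{v : Fin n | (v : ℕ) % r = k} ∧ #{v : Fin n | (v : ℕ) % r = k} ≤ n / r + 1 := by
  have h : #{v : Fin n | (v : ℕ) % r = k} = n.count (· ≡ k [MOD r]) := by
    rw [Nat.count_eq_card_filter_range, card_filter, card_filter,
      ← Fin.sum_univ_eq_sum_range (fun i => if i ≡ k [MOD r] then 1 else 0) n]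
    refine sum_congr rfl fun v _ => ?_
    simp [Nat.ModEq, Nat.mod_eq_of_lt hk]
  rw [h, Nat.count_modEq_card _ (by omega)]
  split_ifs <;> omega

theorem card_nonadj_turanGraph_mul_le {n r : ℕ} (hr : 0 < r) :
    #{x : Fin n × Fin n | x.1 ≠ x.2 ∧ ¬(SimpleGraph.turanGraph n r).Adj x.1 x.2} * r ≤ n ^ 2 := by
  rw [card_filter_prod fun v w => v ≠ w ∧ ¬(SimpleGraph.turanGraph n r).Adj v w]
  have : ∀ v : Fin n, #{w | v ≠ w ∧ ¬(SimpleGraph.turanGraph n r).Adj v w} ≤ n / r := by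
    intro v
    have h1 : #{w | v ≠ w ∧ ¬(SimpleGraph.turanGraph n r).Adj v w} ≤
        #((univ.filter fun w : Fin n => (w : ℕ) % r = v % r).erase v) := by
      refine card_le_card fun w hw => ?_
      simp only [mem_filter, mem_univ, true_and, SimpleGraph.turanGraph_adj, not_not] at hw
      simpa using ⟨hw.1.symm, hw.2.symm⟩
    -- Discarding v itself cancels the +1 in the bound for a larger part.
    rw [card_erase_of_mem (by simp)] at h1
    exact h1.trans
      (Nat.sub_le_iff_le_add.2 (card_fiber_mod (n := n) (Nat.mod_lt (v : ℕ) hr)).2)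
  calc _ ≤ (∑ v : Fin n, n / r) * r := Nat.mul_le_mul_right _ (sum_le_sum fun v _ => this v)
    _ = n * (n / r * r) := by simp [mul_assoc]
    _ ≤ n * n := Nat.mul_le_mul_left _ (Nat.div_mul_le_self n r)
    _ = n ^ 2 := (sq n).symm

/-- All but few injections are homomorphisms into a graph with few non-adjacent pairs. -/
theorem mul_extCount_le_card_injHoms {H : SimpleGraph W} {a b : W} (hab : a ≠ b)
    (G : SimpleGraph V) (hV : 2 ≤ Fintype.card V) :
    Fintype.card V * (Fintype.card V - 1) * extCount W V 2 ≤ #(injHoms H G) +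
      Fintype.card W ^ 2 * (#{x : V × V | x.1 ≠ x.2 ∧ ¬G.Adj x.1 x.2} * extCount W V 2) := by
  set R : Finset (V × V) := {x | x.1 ≠ x.2 ∧ ¬G.Adj x.1 x.2} with hR
  set P : Finset (W × W) := {p | p.1 ≠ p.2} with hP
  rw [← card_embedding_eq_mul hab hV, ← card_univ]
  have hsub : (univ : Finset (W ↪ V)) ⊆
      injHoms H G ∪ P.biUnion fun p => {φ : W ↪ V | (φ p.1, φ p.2) ∈ R} := by
    intro φ _
    rw [mem_union, mem_injHoms]
    by_contra! h
    obtain ⟨⟨c, d, hcd, h1⟩, h2⟩ := h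
    refine h2 ?_
    simp only [mem_biUnion, hP, hR, mem_filter, mem_univ, true_and]
    exact ⟨(c, d), hcd.ne, φ.injective.ne hcd.ne, h1⟩
  refine (card_le_card hsub).trans ((card_union_le _ _).trans (Nat.add_le_add_left ?_ _))
  refine (card_biUnion_le.trans (sum_le_card_nsmul _ _ (#R * extCount W V 2)
    fun p hp => ?_)).trans ?_
  · refine le_of_eq (card_filter_pair_mem (by simpa [hP] using hp) R fun q hq => ?_)
    simp only [hR, mem_filter] at hq
    exact hq.2.1
  · rw [smul_eq_mul]
    refine Nat.mul_le_mul_right _ ((card_le_univ _).trans ?_)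
    rw [Fintype.card_prod, sq]

/-! ### Maximisers of the penalised count have few non-neighbours at each vertex -/

theorem sum_card_injHoms_through (H : SimpleGraph W) (G : SimpleGraph V) :
    ∑ w, #{φ ∈ injHoms H G | ∃ a, φ a = w} = Fintype.card W * #(injHoms H G) := by
  simp_rw [card_filter]
  rw [sum_comm, mul_comm, ← smul_eq_mul, ← sum_const]
  refine sum_congr rfl fun φ _ => ?_
  rw [← card_filter, ← card_univ, ← card_map φ]
  congr 1
  ext v
  simp

/-- If `a` goes to u, then `b` must go to a neighbour of u; the other h − 1 positions of u are
bounded trivially. The +1 appears because u counts among its own non-neighbours. -/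
theorem card_injHoms_through_le {H : SimpleGraph W} {a b : W} (hab : H.Adj a b)
    (G : SimpleGraph V) (hV : 2 ≤ Fintype.card V) (u : V) :
    #{φ ∈ injHoms H G | ∃ c, φ c = u} + #{w | ¬G.Adj u w} * extCount W V 2 ≤
      (Fintype.card W * (Fintype.card V - 1) + 1) * extCount W V 2 := by
  have h2 := two_le_card_of_ne hab.ne
  have e1 : extCount W V 1 = (Fintype.card V - 1) * extCount W V 2 :=
    extCount_succ (by omega) (by omega)
  have hsub : {φ ∈ injHoms H G | ∃ c, φ c = u} ⊆
      (univ.filter fun φ : W ↪ V => (φ a, φ b) ∈ ({u} : Finset V) ×ˢ univ.filter fun w => G.Adj u w) ∪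
        (univ.erase a).biUnion fun c => {φ : W ↪ V | φ c = u} := by
    intro φ hφ
    rw [mem_filter, mem_injHoms] at hφ
    obtain ⟨h, c, hc⟩ := hφ
    rw [mem_union]
    by_cases hca : c = a
    · left
      subst hca
      have := h _ _ hab
      rw [hc] at this
      simp [hc, this]
    · right
      simp only [mem_biUnion, mem_erase, mem_univ, and_true, mem_filter, true_and]
      exact ⟨c, hca, hc⟩
  have h3 : #{φ ∈ injHoms H G | ∃ c, φ c = u} ≤ #{w | G.Adj u w} * extCount W V 2 +
      (Fintype.card W - 1) * extCount W V 1 := by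
    refine (card_le_card hsub).trans ((card_union_le _ _).trans (Nat.add_le_add ?_ ?_))
    · rw [card_filter_pair_mem hab.ne, card_product, card_singleton, one_mul]
      intro p hp
      simp only [mem_product, mem_singleton, mem_filter, mem_univ, true_and] at hp
      exact hp.1 ▸ hp.2.ne
    · refine card_biUnion_le.trans ((sum_le_card_nsmul _ _ (extCount W V 1)
        fun c _ => (card_extensions_one c u).le).trans ?_)
      rw [card_erase_of_mem (mem_univ a), card_univ, smul_eq_mul]
  have h4 := card_filter_add_card_filter_not (s := (univ : Finset V)) fun w => G.Adj u w
  rw [card_univ] at h4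
  rw [e1] at h3
  clear hsub e1
  generalize extCount W V 2 = F at *
  obtain ⟨h, hh⟩ : ∃ h, Fintype.card W = h + 1 := ⟨Fintype.card W - 1, by omega⟩
  obtain ⟨n, hn⟩ : ∃ n, Fintype.card V = n + 1 := ⟨Fintype.card V - 1, by omega⟩
  rw [hh, hn, Nat.add_sub_cancel, Nat.add_sub_cancel] at h3
  rw [hh, hn, Nat.add_sub_cancel]
  rw [hn] at h4
  have h5 := congrArg (· * F) h4
  linarith

theorem card_adjPairs_replaceVertex_le (G : SimpleGraph V) (u w : V) :
    #(adjPairs (G.replaceVertex w u)) ≤ #(adjPairs G) + 2 * Fintype.card V := by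
  have : adjPairs (G.replaceVertex w u) ⊆
      adjPairs G ∪ (({u} : Finset V) ×ˢ univ ∪ univ ×ˢ ({u} : Finset V)) := by
    rintro ⟨x, y⟩ h
    simp only [mem_union, mem_product, mem_singleton, mem_univ, and_true, true_and, mem_adjPairs]
      at h ⊢
    by_cases hx : x = u
    · exact Or.inr (Or.inl hx)
    by_cases hy : y = u
    · exact Or.inr (Or.inr hy)
    · exact Or.inl ((G.adj_replaceVertex_iff_of_ne _ hx hy).1 h)
  refine (card_le_card this).trans ((card_union_le _ _).trans (Nat.add_le_add_left ?_ _))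
  refine (card_union_le _ _).trans ?_
  simp only [card_product, card_singleton, card_univ]
  omega

/-- In a `K_{r+1}`-free graph that maximises the number of copies of `H`, penalised by a small
multiple of the number of edges, each vertex has few non-neighbours. -/
theorem card_not_adj_le_of_maximal {H : SimpleGraph W} {a b : W} (hab : H.Adj a b) {r : ℕ}
    (hr : 0 < r) (hrn : r ≤ Fintype.card V) (hWV : Fintype.card W ≤ Fintype.card V)
    {G T : SimpleGraph V} (hG : G.CliqueFree (r + 1)) (hT : T.CliqueFree (r + 1))
    (hTr : #{x : V × V | x.1 ≠ x.2 ∧ ¬T.Adj x.1 x.2} * r ≤ Fintype.card V ^ 2)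
    (hmax : ∀ G' : SimpleGraph V, G'.CliqueFree (r + 1) →
      r * #(injHoms H G') + extCount W V 2 * #(adjPairs G) ≤
        r * #(injHoms H G) + extCount W V 2 * #(adjPairs G')) (u : V) :
    r * #{w | ¬G.Adj u w} ≤ 3 * Fintype.card W ^ 3 * Fintype.card V := by
  have h2 := two_le_card_of_ne hab.ne
  have hF := extCount_pos hWV 2
  have low := mul_extCount_le_card_injHoms (H := H) hab.ne T (by omega)
  have up := card_injHoms_through_le hab G (by omega) u
  have hm := hmax T hT
  have haT : #(adjPairs T) ≤ Fintype.card V ^ 2 := by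
    refine (card_le_univ _).trans ?_
    rw [Fintype.card_prod, sq]
  -- A vertex in at least the average number of copies.
  obtain ⟨w, hw⟩ : ∃ w, Fintype.card W * #(injHoms H G) ≤
      Fintype.card V * #{φ ∈ injHoms H G | ∃ a, φ a = w} := by
    have : Nonempty V := ⟨u⟩
    obtain ⟨w, -, hw⟩ := exists_max_image univ
      (fun w : V => #{φ ∈ injHoms H G | ∃ a : W, φ a = w}) univ_nonempty
    refine ⟨w, ?_⟩
    rw [← sum_card_injHoms_through]
    exact (sum_le_card_nsmul _ _ _ fun v hv => hw v hv).trans (by rw [card_univ, smul_eq_mul])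
  have clone : r * #{φ ∈ injHoms H G | ∃ a, φ a = w} ≤
      r * #{φ ∈ injHoms H G | ∃ a, φ a = u} + r * (Fintype.card W ^ 2 * extCount W V 2) +
        2 * Fintype.card V * extCount W V 2 := by
    by_cases huw : u = w
    · subst huw
      omega
    · have h3 := card_injHoms_replaceVertex H G huw
      have h4 := hmax _ (hG.replaceVertex w u)
      have h5 := card_adjPairs_replaceVertex_le G u w
      have h6 := Nat.mul_le_mul_left r h3
      have h7 := Nat.mul_le_mul_left (extCount W V 2) h5
      linarith
  generalize extCount W V 2 = F at *
  generalize #{φ ∈ injHoms H G | ∃ a, φ a = w} = iw at *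
  generalize #{φ ∈ injHoms H G | ∃ a, φ a = u} = iu at *
  generalize #(injHoms H G) = iG at *
  generalize #(injHoms H T) = iT at *
  generalize #{x : V × V | x.1 ≠ x.2 ∧ ¬T.Adj x.1 x.2} = N at *
  generalize #{w | ¬G.Adj u w} = d at *
  generalize #(adjPairs T) = aT at *
  generalize #(adjPairs G) = aG at *
  generalize Fintype.card W = h at *
  generalize Fintype.card V = m at *
  obtain ⟨n, rfl⟩ : ∃ n, m = n + 1 := ⟨m - 1, by omega⟩
  simp only [Nat.add_sub_cancel] at low up
  -- Comparison with `T`: h² accounts for the injections into `T` that are not homomorphisms, 1 for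
  -- the edge penalty.
  have s1 : r * ((n + 1) * n * F) ≤ r * iG + (h ^ 2 + 1) * (n + 1) ^ 2 * F := by
    have t1 := Nat.mul_le_mul_left r low
    have t2 := Nat.mul_le_mul_left (h ^ 2 * F) hTr
    have t3 := Nat.mul_le_mul_left F haT
    nlinarith
  have s2 : h * (r * ((n + 1) * n * F)) ≤
      r * ((n + 1) * iw) + h * ((h ^ 2 + 1) * (n + 1) ^ 2 * F) := by
    have t1 := Nat.mul_le_mul_left h s1
    have t2 := Nat.mul_le_mul_left r hw
    linarith
  have s3 : (n + 1) * (r * iw) + (n + 1) * (r * (d * F)) ≤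
      (n + 1) * (r * ((h * n + 1) * F)) + (n + 1) * (r * (h ^ 2 * F)) +
        (n + 1) * (2 * (n + 1) * F) := by
    have t1 := Nat.mul_le_mul_left (n + 1) clone
    have t2 := Nat.mul_le_mul_left (n + 1) (Nat.mul_le_mul_left r up)
    linarith
  have s4 : (r * d) * ((n + 1) * F) ≤
      (r + r * h ^ 2 + (h * (h ^ 2 + 1) + 2) * (n + 1)) * ((n + 1) * F) := by
    linarith
  have s5 := Nat.le_of_mul_le_mul_right s4 (by positivity)
  have s6 : r + r * h ^ 2 ≤ (1 + h ^ 2) * (n + 1) := by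
    have := Nat.mul_le_mul_left (1 + h ^ 2) hrn
    linarith
  have s7 : 3 + h ^ 2 + h + h ^ 3 ≤ 3 * h ^ 3 := by
    obtain ⟨g, rfl⟩ : ∃ g, h = g + 2 := ⟨h - 2, by omega⟩
    ring_nf
    nlinarith [sq_nonneg g, pow_nonneg (Nat.zero_le g) 3]
  have s8 := Nat.mul_le_mul_right (n + 1) s7
  linarith

/-! ### The maximiser is the Turán graph -/

/-- For integers, (x − q)(x − q − 1) ≥ 0, with equality at q and q + 1. Thus x² lies above a linear
function that is attained by every `p k`, and the linear sums agree. -/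
theorem sum_sq_le_of_balanced {r q : ℕ} {p t : ℕ → ℕ}
    (hsum : ∑ k ∈ range r, p k = ∑ k ∈ range r, t k)
    (hp : ∀ k ∈ range r, q ≤ p k ∧ p k ≤ q + 1) :
    ∑ k ∈ range r, p k ^ 2 ≤ ∑ k ∈ range r, t k ^ 2 := by
  zify at hsum ⊢
  have h1 : ∀ k ∈ range r, (p k : ℤ) ^ 2 = (2 * q + 1) * p k - q * (q + 1) := by
    intro k hk
    obtain ⟨h1, h2⟩ := hp k hk
    obtain h | h : p k = q ∨ p k = q + 1 := by omega
    · rw [h]; ring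
    · rw [h]; push_cast; ring
  have h2 : ∀ k ∈ range r, ((2 * q + 1) * t k - q * (q + 1) : ℤ) ≤ (t k : ℤ) ^ 2 := by
    intro k _
    rcases le_or_gt (t k) q with h | h
    · have : (0 : ℤ) ≤ (q - t k) * (q + 1 - t k) := mul_nonneg (by omega) (by omega)
      linarith
    · have : (0 : ℤ) ≤ (t k - q) * (t k - (q + 1)) := mul_nonneg (by omega) (by omega)
      linarith
  rw [sum_congr rfl h1]
  refine le_trans (le_of_eq ?_) (sum_le_sum h2)
  simp only [sum_sub_distrib, ← mul_sum, hsum]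

theorem card_adjPairs_move {f : V → ℕ} {r : ℕ} (hf : ∀ v, f v < r) {u : V} {j x : ℕ} (hj : j < r)
    (hx : x + #{v | f v = j} + 1 = #{v | f v = f u}) :
    #(adjPairs (multipartite (Function.update f u j))) = #(adjPairs (multipartite f)) + 2 * x := by
  have hne : f u ≠ j := by rintro h; rw [h] at hx; omega
  have hf' : ∀ v, Function.update f u j v < r := by
    intro v
    by_cases hv : v = u
    · subst hv; simpa using hj
    · simpa [hv] using hf v
  have h1 := card_adjPairs_multipartite hf
  have h2 := card_adjPairs_multipartite hf'
  have h3 : (∑ k ∈ range r, (#{v | Function.update f u j v = k} : ℤ) ^ 2) =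
      (∑ k ∈ range r, (#{v | f v = k} : ℤ) ^ 2) + (2 * #{v | f v = j} + 1) +
        (-2 * #{v | f v = f u} + 1) := by
    have e : ∀ k ∈ range r, (#{v | Function.update f u j v = k} : ℤ) ^ 2 =
        (#{v | f v = k} : ℤ) ^ 2 + (if k = j then (2 * #{v | f v = k} + 1 : ℤ) else 0) +
          (if k = f u then (-2 * #{v | f v = k} + 1 : ℤ) else 0) := by
      intro k _
      rw [card_fiber_update hne k]
      by_cases h : k = j
      · subst h
        simp only [if_true, if_neg hne.symm]; ring
      · by_cases h' : k = f u
        · simp only [if_pos h', if_neg h]; ring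
        · simp only [if_neg h', if_neg h]; ring
    rw [sum_congr rfl e, sum_add_distrib, sum_add_distrib, sum_ite_eq', sum_ite_eq',
      if_pos (mem_range.2 hj), if_pos (mem_range.2 (hf u))]
  have h1' := congrArg (Nat.cast : ℕ → ℤ) h1
  have h2' := congrArg (Nat.cast : ℕ → ℤ) h2
  have hx' := congrArg (Nat.cast : ℕ → ℤ) hx
  push_cast at h1' h2' hx'
  rw [← Nat.cast_inj (R := ℤ)]
  push_cast
  linarith

/-- This fixes the threshold for r: 300h⁹ ≤ r turns D ≤ 3h³n/r into D ≤ n/(100h⁶), and h³ ≥ 8 then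
makes 8h³D at most n/100. -/
theorem parameter_bound {h r n D : ℕ} (h2 : 2 ≤ h) (hr : 300 * h ^ 9 ≤ r) (hrn : r ≤ n)
    (hD : D * r ≤ 3 * h ^ 3 * n) : 4 * h ^ 3 * (2 * D) + 4 ≤ n := by
  have h3 : 8 ≤ h ^ 3 := by
    calc 8 = 2 ^ 3 := by norm_num
      _ ≤ h ^ 3 := Nat.pow_le_pow_left h2 3
  have a1 : 3 * h ^ 3 * (100 * h ^ 6 * D) ≤ 3 * h ^ 3 * n := by
    calc 3 * h ^ 3 * (100 * h ^ 6 * D) = D * (300 * h ^ 9) := by ring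
      _ ≤ D * r := Nat.mul_le_mul_left _ hr
      _ ≤ _ := hD
  have a2 : 100 * h ^ 6 * D ≤ n := Nat.le_of_mul_le_mul_left a1 (by positivity)
  have a3 : 800 * h ^ 3 * D ≤ n := by
    refine le_trans ?_ a2
    have : 800 * h ^ 3 ≤ 100 * h ^ 6 := by nlinarith
    exact Nat.mul_le_mul_right _ this
  have a4 : 8 ≤ n := by
    have : 1 ≤ h ^ 9 := Nat.one_le_pow _ _ (by omega)
    omega
  have a5 : 4 * h ^ 3 * (2 * D) * 100 = 800 * h ^ 3 * D := by ring
  omega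

/-- Here the Turán graph is complete, and every ordered pair missing from G rules out all injections
that send a fixed edge ab to it. -/
theorem turan_bound_of_le {H : SimpleGraph W} (hH : H ≠ ⊥) {r n : ℕ} (hr : 0 < r) (hnr : n ≤ r)
    (G : SimpleGraph (Fin n)) :
    r * #(injHoms H G) + extCount W (Fin n) 2 * #(adjPairs (SimpleGraph.turanGraph n r)) ≤
      r * #(injHoms H (SimpleGraph.turanGraph n r)) + extCount W (Fin n) 2 * #(adjPairs G) := by
  obtain ⟨a, b, hab⟩ := SimpleGraph.ne_bot_iff_exists_adj.1 hH
  rw [SimpleGraph.turanGraph_eq_top.2 (Or.inr hnr)]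
  set R := adjPairs (⊤ : SimpleGraph (Fin n)) \ adjPairs G with hR
  have h1 : #R + #(adjPairs G) = #(adjPairs (⊤ : SimpleGraph (Fin n))) :=
    card_sdiff_add_card_eq_card fun p hp => mem_adjPairs.2 (mem_adjPairs.1 hp).ne
  have h2 : #(injHoms H G) + #R * extCount W (Fin n) 2 ≤
      #(injHoms H (⊤ : SimpleGraph (Fin n))) := by
    rw [← card_filter_pair_mem hab.ne R fun p hp => (mem_adjPairs.1 (mem_sdiff.1 hp).1).ne,
      ← card_union_of_disjoint]
    · refine card_le_card fun φ _ => mem_injHoms.2 fun c d hcd => φ.injective.ne hcd.ne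
    · rw [disjoint_left]
      intro φ h3 h4
      simp only [mem_filter, mem_univ, true_and, hR, mem_sdiff, mem_adjPairs] at h4
      exact h4.2 (mem_injHoms.1 h3 a b hab)
  rw [← h1]
  have h3 := Nat.mul_le_mul_left r h2
  have h4 : #R * extCount W (Fin n) 2 ≤ r * (#R * extCount W (Fin n) 2) :=
    Nat.le_mul_of_pos_left _ hr
  linarith

/-- A maximiser of the penalised number of copies is complete `r`-partite, with small parts. -/
theorem exists_eq_multipartite_of_maximal {H : SimpleGraph W} (hH : H ≠ ⊥) {r D : ℕ} (hr : 4 < r)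
    (hWV : Fintype.card W ≤ Fintype.card V)
    {G : SimpleGraph V} (hG : G.CliqueFree (r + 1)) (hD : ∀ u, #{w | ¬G.Adj u w} ≤ D)
    (hn : 8 * Fintype.card W ^ 2 * (2 * D) + 4 ≤ Fintype.card V)
    (hmax : ∀ G' : SimpleGraph V, G'.CliqueFree (r + 1) →
      r * #(injHoms H G') + extCount W V 2 * #(adjPairs G) ≤
        r * #(injHoms H G) + extCount W V 2 * #(adjPairs G')) :
    ∃ f : V → ℕ, (∀ v, f v < r) ∧ G = multipartite f := by
  obtain ⟨f, hf, hIM⟩ := exists_partition hG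
  refine ⟨f, hf, ?_⟩
  have hF := extCount_pos hWV 2
  -- Neighbours of x in its own part are outnumbered by its non-neighbours, so each of the two kinds
  -- of disagreement contributes at most `D`.
  have hD' : ∀ x, #{y | ¬(G.Adj x y ∧ (multipartite f).Adj x y)} ≤ 2 * D := by
    intro x
    have h1 : #{y | ¬(G.Adj x y ∧ (multipartite f).Adj x y)} ≤
        #{y | ¬G.Adj x y} + #{y | f y = f x ∧ G.Adj x y} := by
      refine le_trans (card_le_card fun y hy => ?_) (card_union_le _ _)
      simp only [mem_union, mem_filter, mem_univ, true_and, multipartite_adj] at hy ⊢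
      by_cases h : G.Adj x y
      · right
        refine ⟨?_, h⟩
        by_contra h'
        exact hy ⟨h, Ne.symm h'⟩
      · exact Or.inl h
    have h2 : #{y | f x < f y ∧ ¬G.Adj x y} ≤ #{y | ¬G.Adj x y} := by
      refine card_le_card fun y hy => ?_
      simp only [mem_filter, mem_univ, true_and] at hy ⊢
      exact hy.2
    have h3 := hIM x
    have h4 := hD x
    omega
  have hIM' := two_mul_card_adjPairs_sdiff_le hIM
  have h1 := card_injHoms_add_le hH hD' hn hIM'
  have h2 := hmax _ (multipartite_cliqueFree hf)
  have h3 : #(adjPairs (multipartite f)) ≤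
      #(adjPairs (multipartite f) \ adjPairs G) + #(adjPairs G) := by
    rw [← card_sdiff_add_card_inter (adjPairs (multipartite f)) (adjPairs G)]
    exact Nat.add_le_add_left (card_le_card inter_subset_right) _
  have h4 : #(adjPairs (multipartite f) \ adjPairs G) = 0 := by
    set m := #(adjPairs (multipartite f) \ adjPairs G) with hm
    have h5 := Nat.mul_le_mul_left r h1
    have h6 := Nat.mul_le_mul_left (extCount W V 2) h3
    -- Completing to the multipartite graph gains at least r·F·m/4 and costs at most F·m in penalty,
    -- so r > 4 forces m = 0.
    have h7 : r * (extCount W V 2 * m) ≤ 4 * (extCount W V 2 * m) := by linarith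
    by_contra h8
    have h9 : 0 < extCount W V 2 * m := Nat.mul_pos hF (Nat.pos_of_ne_zero h8)
    have := Nat.le_of_mul_le_mul_right h7 h9
    omega
  have h5 : #(adjPairs G \ adjPairs (multipartite f)) = 0 := by omega
  rw [card_eq_zero, sdiff_eq_empty_iff_subset] at h4 h5
  ext v w
  exact ⟨fun h => mem_adjPairs.1 (h5 (mem_adjPairs.2 h : (v, w) ∈ adjPairs G)),
    fun h => mem_adjPairs.1 (h4 (mem_adjPairs.2 h : (v, w) ∈ adjPairs (multipartite f)))⟩

/-- The parts of a complete multipartite maximiser differ by at most one. -/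
theorem card_fiber_le_of_maximal {H : SimpleGraph W} (hH : H ≠ ⊥) {r D : ℕ} (hr : 4 < r)
    (hWV : Fintype.card W ≤ Fintype.card V) {f : V → ℕ} (hf : ∀ v, f v < r)
    (hD : ∀ k, #{v | f v = k} ≤ D) (hn : 4 * Fintype.card W ^ 3 * D + 4 ≤ Fintype.card V)
    (hmax : ∀ G' : SimpleGraph V, G'.CliqueFree (r + 1) →
      r * #(injHoms H G') + extCount W V 2 * #(adjPairs (multipartite f)) ≤
        r * #(injHoms H (multipartite f)) + extCount W V 2 * #(adjPairs G'))
    {j : ℕ} (hj : j < r) (k : ℕ) : #{v | f v = k} ≤ #{v | f v = j} + 1 := by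
  by_contra! hlt
  obtain ⟨u, hu⟩ : ({v | f v = k} : Finset V).Nonempty := card_pos.1 (by omega)
  obtain rfl : f u = k := by simpa using hu
  obtain ⟨x, hx⟩ : ∃ x, x + #{v | f v = j} + 1 = #{v | f v = f u} :=
    ⟨#{v | f v = f u} - #{v | f v = j} - 1, by omega⟩
  have hx0 : 0 < x := by omega
  have h1 := card_injHoms_move hH hD hx hn
  have h2 := card_adjPairs_move hf hj hx
  have h3 := hmax (multipartite (Function.update f u j)) (multipartite_cliqueFree fun v => by
    by_cases hv : v = u
    · subst hv; simpa using hj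
    · simpa [hv] using hf v)
  rw [h2] at h3
  have h4 := Nat.mul_le_mul_left r h1
  -- The move gains at least r·x·F/2 and its 2x new ordered pairs cost 2x·F.
  have h5 : r * (x * extCount W V 2) ≤ 4 * (x * extCount W V 2) := by linarith
  have := Nat.le_of_mul_le_mul_right h5 (Nat.mul_pos hx0 (extCount_pos hWV 2))
  omega

/-- The Turán graph has the largest number of copies of `H` among all `K_{r+1}`-free graphs, by a
margin proportional to the number of missing edges. -/
theorem turan_bound {H : SimpleGraph W} (hH : H ≠ ⊥) {r n : ℕ} (hr : 300 * Fintype.card W ^ 9 ≤ r)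
    (hn : Fintype.card W ≤ n) {G : SimpleGraph (Fin n)} (hG : G.CliqueFree (r + 1)) :
    r * #(injHoms H G) + extCount W (Fin n) 2 * #(adjPairs (SimpleGraph.turanGraph n r)) ≤
      r * #(injHoms H (SimpleGraph.turanGraph n r)) + extCount W (Fin n) 2 * #(adjPairs G) := by
  obtain ⟨a, b, hab⟩ := SimpleGraph.ne_bot_iff_exists_adj.1 hH
  have h2 := two_le_card_of_ne hab.ne
  have hr4 : 4 < r := by
    have : 1 ≤ Fintype.card W ^ 9 := Nat.one_le_pow _ _ (by omega)
    omega
  rcases le_or_gt n r with hnr | hrn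
  · exact turan_bound_of_le hH (by omega) hnr G
  set T := SimpleGraph.turanGraph n r with hT
  have hTfree : T.CliqueFree (r + 1) := SimpleGraph.turanGraph_cliqueFree (by omega)
  have hcard : Fintype.card (Fin n) = n := Fintype.card_fin n
  have hWn : Fintype.card W ≤ Fintype.card (Fin n) := hcard.symm ▸ hn
  obtain ⟨M, hM, hMmax⟩ := exists_max_image
    (univ.filter fun G : SimpleGraph (Fin n) => G.CliqueFree (r + 1))
    -- Integers are needed, as the penalised count may be negative.
    (fun G => (r * #(injHoms H G) : ℤ) - extCount W (Fin n) 2 * #(adjPairs G))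
    ⟨T, by simpa using hTfree⟩
  have hMfree : M.CliqueFree (r + 1) := by simpa using hM
  have hmax : ∀ G' : SimpleGraph (Fin n), G'.CliqueFree (r + 1) →
      r * #(injHoms H G') + extCount W (Fin n) 2 * #(adjPairs M) ≤
        r * #(injHoms H M) + extCount W (Fin n) 2 * #(adjPairs G') := by
    intro G' hG'
    have := hMmax G' (by simpa using hG')
    zify
    linarith
  set D := 3 * Fintype.card W ^ 3 * n / r with hDdef
  have hD : ∀ u, #{w | ¬M.Adj u w} ≤ D := by
    intro u
    rw [hDdef, Nat.le_div_iff_mul_le (by omega), mul_comm]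
    have := card_not_adj_le_of_maximal hab (by omega) (hcard.symm ▸ hrn.le) hWn
      hMfree hTfree (by
        rw [hcard]
        convert card_nonadj_turanGraph_mul_le (n := n) (r := r) (by omega)) hmax u
    rwa [hcard] at this
  have hpar : 4 * Fintype.card W ^ 3 * (2 * D) + 4 ≤ n :=
    parameter_bound h2 hr hrn.le (Nat.div_mul_le_self _ _)
  obtain ⟨f, hf, rfl⟩ := exists_eq_multipartite_of_maximal hH hr4 hWn hMfree hD
    (by
      rw [hcard]
      refine le_trans (Nat.add_le_add_right (Nat.mul_le_mul_right _ ?_) _) hpar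
      rw [pow_succ _ 2]
      nlinarith [sq_nonneg (Fintype.card W)]) hmax
  have hfD : ∀ k, #{v | f v = k} ≤ 2 * D := by
    intro k
    rcases ({v | f v = k} : Finset (Fin n)).eq_empty_or_nonempty with h | ⟨u, hu⟩
    · rw [h]; simp
    · obtain rfl : f u = k := by simpa using hu
      refine le_trans (card_le_card fun v hv => ?_) ((hD u).trans (by omega))
      simp only [mem_filter, mem_univ, true_and, multipartite_adj, not_not] at hv ⊢
      exact hv.symm
  have hbal := fun {j : ℕ} (hj : j < r) (k : ℕ) =>
    card_fiber_le_of_maximal hH hr4 hWn hf hfD (by rw [hcard]; exact hpar)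
      hmax hj k
  obtain ⟨i, hi, himin⟩ := exists_min_image (range r) (fun k => #{v | f v = k})
    ⟨0, mem_range.2 (by omega)⟩
  have hsq := sum_sq_le_of_balanced (r := r) (q := #{v | f v = i}) (p := fun k => #{v | f v = k})
    (t := fun k => #{v : Fin n | (v : ℕ) % r = k})
    (by rw [sum_card_fiber hf, sum_card_fiber fun v => Nat.mod_lt _ (by omega)])
    (fun k hk => ⟨himin k hk, hbal (mem_range.1 hi) k⟩)
  have e1 := card_adjPairs_multipartite hf
  have e2 := card_adjPairs_multipartite (f := fun v : Fin n => (v : ℕ) % r) (r := r)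
    fun v => Nat.mod_lt _ (by omega)
  rw [← turanGraph_eq_multipartite, ← hT] at e2
  -- Balanced parts minimise the sum of squares, hence maximise the number of edges.
  have hTle : #(adjPairs T) ≤ #(adjPairs (multipartite f)) := by
    omega
  obtain ⟨e⟩ := nonempty_iso_turanGraph (by omega) hMfree hTle
  have h5 := card_injHoms_le_of_iso H e
  have h6 := hmax G hG
  have h7 := Nat.mul_le_mul_left r h5
  have h8 := Nat.mul_le_mul_left (extCount W (Fin n) 2) hTle
  linarith

/-! ### Stability for the number of edges -/

/-- A colouring can be turned into one with prescribed part sizes by recolouring the excess. -/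
theorem exists_recolouring {r : ℕ} {t : ℕ → ℕ} (ht : ∑ k ∈ range r, t k = Fintype.card V) (s : ℕ) :
    ∀ f : V → ℕ, (∀ v, f v < r) → ∑ k ∈ range r, (#{v | f v = k} - t k) ≤ s →
      ∃ g : V → ℕ, (∀ v, g v < r) ∧ (∀ k < r, #{v | g v = k} = t k) ∧ #{v | f v ≠ g v} ≤ s := by
  induction s with
  | zero =>
    intro f hf hs
    refine ⟨f, hf, ?_, by simp⟩
    have hle : ∀ k ∈ range r, #{v | f v = k} ≤ t k := by
      intro k hk
      have := (Finset.sum_eq_zero_iff.1 (Nat.le_zero.1 hs)) k hk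
      omega
    have := (Finset.sum_eq_sum_iff_of_le hle).1 ((sum_card_fiber hf).trans ht.symm)
    exact fun k hk => this k (mem_range.2 hk)
  | succ s ih =>
    intro f hf hs
    by_cases hex : ∃ i ∈ range r, t i < #{v | f v = i}
    · obtain ⟨i, hi, hti⟩ := hex
      obtain ⟨j, hj, htj⟩ : ∃ j ∈ range r, #{v | f v = j} < t j := by
        by_contra! h
        have := sum_lt_sum h ⟨i, hi, hti⟩
        rw [ht, sum_card_fiber hf] at this
        exact lt_irrefl _ this
      obtain ⟨u, hu⟩ : ({v | f v = i} : Finset V).Nonempty := card_pos.1 (by omega)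
      obtain rfl : f u = i := by simpa using hu
      have hne : f u ≠ j := by rintro rfl; omega
      -- Truncated subtraction counts only overfull classes, so moving a vertex from an overfull to
      -- an underfull class lowers the sum.
      have hlt : ∑ k ∈ range r, (#{v | Function.update f u j v = k} - t k) <
          ∑ k ∈ range r, (#{v | f v = k} - t k) := by
        refine sum_lt_sum (fun k _ => ?_) ⟨f u, hi, ?_⟩
        · have h := card_fiber_update hne k
          by_cases hk : k = j
          · subst hk
            simp only [if_true, if_neg hne.symm] at h
            omega
          · rw [if_neg hk] at h
            split_ifs at h <;> omega
        · have h := card_fiber_update hne (f u)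
          simp only [if_true, if_neg hne] at h
          omega
      obtain ⟨g, hg, hgt, hgf⟩ := ih (Function.update f u j) (fun v => by
        by_cases hv : v = u
        · subst hv; simpa using hj
        · simpa [hv] using hf v) (by omega)
      refine ⟨g, hg, hgt, ?_⟩
      have hsub : univ.filter (fun v => f v ≠ g v) ⊆
          insert u (univ.filter fun v => Function.update f u j v ≠ g v) := by
        intro v hv
        by_cases h : v = u
        · simp [h]
        · simpa [h] using hv
      have := (card_le_card hsub).trans (card_insert_le _ _)
      omega
    · push Not at hex
      obtain ⟨g, hg, hgt, hgf⟩ := ih f hf (by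
        rw [sum_eq_zero fun k hk => Nat.sub_eq_zero_of_le (hex k hk)]
        omega)
      exact ⟨g, hg, hgt, hgf.trans (Nat.le_succ s)⟩

theorem editDist_le_card_symmDiff {G G' G'' : SimpleGraph V} (e : G'' ≃g G') :
    editDist G G' ≤ #(symmDiff (adjPairs G) (adjPairs G'')) := by
  refine (Nat.sInf_le ⟨G'', ⟨e⟩, rfl⟩ : editDist G G' ≤ _).trans ?_
  have hsub : symmDiff G.edgeSet G''.edgeSet ⊆
      (fun p : V × V => s(p.1, p.2)) '' (symmDiff (adjPairs G) (adjPairs G'') : Finset (V × V)) := by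
    intro x
    induction x with
    | _ a b =>
      intro h
      refine ⟨(a, b), ?_, rfl⟩
      simpa [Set.mem_symmDiff, Finset.mem_symmDiff, mem_adjPairs] using h
  refine (Set.ncard_le_ncard hsub (Set.toFinite _)).trans ?_
  refine (Set.ncard_image_le (Set.toFinite _)).trans ?_
  rw [Set.ncard_coe_finset]

theorem card_symmDiff_triangle {α : Type*} [DecidableEq α] (s t u : Finset α) :
    #(symmDiff s u) ≤ #(symmDiff s t) + #(symmDiff t u) :=
  (card_le_card (symmDiff_triangle s t u)).trans (card_union_le _ _)

theorem card_symmDiff_multipartite_le (f g : V → ℕ) :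
    #(symmDiff (adjPairs (multipartite f)) (adjPairs (multipartite g))) ≤
      2 * (Fintype.card V * #{v | f v ≠ g v}) := by
  set Z : Finset V := {v | f v ≠ g v} with hZ
  have : symmDiff (adjPairs (multipartite f)) (adjPairs (multipartite g)) ⊆
      univ ×ˢ Z ∪ Z ×ˢ univ := by
    rintro ⟨v, w⟩ h
    by_contra hc
    simp only [mem_union, mem_product, mem_univ, true_and, and_true, hZ, mem_filter, not_or,
      not_not, ne_eq] at hc
    simp [Finset.mem_symmDiff, mem_adjPairs, hc.1, hc.2] at h
  refine (card_le_card this).trans ((card_union_le _ _).trans (le_of_eq ?_))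
  rw [card_product, card_product, card_univ]
  ring

theorem editDist_eq_zero {G G' : SimpleGraph V} (e : G ≃g G') : editDist G G' = 0 := by
  have := editDist_le_card_symmDiff (G := G) e
  rw [symmDiff_self, bot_eq_empty, card_empty] at this
  exact Nat.le_zero.1 this

/-- A `K_{r+1}`-free graph is close to a complete `r`-partite graph, depending on the difference of
the numbers of edges. -/
theorem exists_multipartite_close {G : SimpleGraph V} {r : ℕ} (hG : G.CliqueFree (r + 1)) :
    ∃ f : V → ℕ, (∀ v, f v < r) ∧ #(adjPairs G) ≤ #(adjPairs (multipartite f)) ∧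
      ∀ (g : V → ℕ) (G' : SimpleGraph V), Nonempty (multipartite g ≃g G') →
        editDist G G' + 3 * #(adjPairs G) ≤
          3 * #(adjPairs (multipartite f)) + 2 * (Fintype.card V * #{v | f v ≠ g v}) := by
  obtain ⟨f, hf, hfG⟩ := exists_partition hG
  have hIM := two_mul_card_adjPairs_sdiff_le hfG
  have c1 := card_sdiff_add_card_inter (adjPairs G) (adjPairs (multipartite f))
  have c2 := card_sdiff_add_card_inter (adjPairs (multipartite f)) (adjPairs G)
  rw [inter_comm] at c2
  refine ⟨f, hf, by omega, ?_⟩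
  rintro g G' ⟨e⟩
  have b1 := editDist_le_card_symmDiff (G := G) e
  have b2 := card_symmDiff_triangle (adjPairs G) (adjPairs (multipartite f))
    (adjPairs (multipartite g))
  have b3 := card_symmDiff_multipartite_le f g
  have b4 : #(symmDiff (adjPairs G) (adjPairs (multipartite f))) ≤
      #(adjPairs G \ adjPairs (multipartite f)) + #(adjPairs (multipartite f) \ adjPairs G) :=
    card_union_le _ _
  -- With I extra and M missing pairs, 2I ≤ M gives I + M ≤ 3(M − I), and M − I is the difference of
  -- the pair counts.
  omega

theorem nonempty_iso_of_card_fiber_eq {r : ℕ} {f g : V → ℕ} (hf : ∀ v, f v < r) (hg : ∀ v, g v < r)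
    (h : ∀ k < r, #{v | f v = k} = #{v | g v = k}) :
    Nonempty (multipartite f ≃g multipartite g) := by
  obtain ⟨e, he⟩ := exists_equiv_of_card_fiber_eq (f := f) (g := g) fun k => by
    by_cases hk : k < r
    · exact h k hk
    · rw [filter_eq_empty_iff.2, filter_eq_empty_iff.2]
      · rintro v - rfl; exact hk (hg v)
      · rintro v - rfl; exact hk (hf v)
  exact ⟨⟨e, fun {v w} => by simp [he]⟩⟩

/-- Parts whose squares have nearly the least possible sum are nearly balanced. -/
theorem sum_abs_sub_le {r q : ℕ} {p t : ℕ → ℤ} {D s : ℝ} (hr : 0 < r)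
    (hsum : ∑ k ∈ range r, p k = ∑ k ∈ range r, t k)
    (ht : ∀ k ∈ range r, (q : ℤ) ≤ t k ∧ t k ≤ q + 1)
    (hD : ((∑ k ∈ range r, p k ^ 2 - ∑ k ∈ range r, t k ^ 2 : ℤ) : ℝ) ≤ D) (hs : 1 ≤ s)
    (hsD : D ≤ s ^ 2) :
    ((∑ k ∈ range r, |p k - t k| : ℤ) : ℝ) ≤ 3 * r * s := by
  set S := ∑ k ∈ range r, |p k - t k| with hS
  -- Expand (p − t)² = p² − t² − 2t(p − t). The part 2q(p − t) sums to zero, and t − q is 0 or 1,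
  -- leaving at most 2|p − t|.
  have h1 : ∑ k ∈ range r, |p k - t k| ^ 2 ≤
      (∑ k ∈ range r, p k ^ 2 - ∑ k ∈ range r, t k ^ 2) + 2 * S := by
    have e : ∀ k ∈ range r, |p k - t k| ^ 2 ≤
        p k ^ 2 - t k ^ 2 + 2 * |p k - t k| - 2 * q * (p k - t k) := by
      intro k hk
      obtain ⟨h1, h2⟩ := ht k hk
      rw [sq_abs]
      have h3 : -|p k - t k| ≤ (t k - q) * (p k - t k) := by
        obtain h | h : t k - q = 0 ∨ t k - q = 1 := by omega
        · rw [h, zero_mul]; exact neg_nonpos.2 (abs_nonneg _)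
        · rw [h, one_mul]; exact neg_abs_le _
      linarith
    refine (sum_le_sum e).trans (le_of_eq ?_)
    rw [sum_sub_distrib, sum_add_distrib, sum_sub_distrib, ← mul_sum, ← mul_sum, sum_sub_distrib,
      hsum]
    ring
  have h2 : S ^ 2 ≤ r * ∑ k ∈ range r, |p k - t k| ^ 2 := by
    simpa using sq_sum_le_card_mul_sum_sq (s := range r) (f := fun k => |p k - t k|)
  have h3 : (S : ℝ) ^ 2 ≤ r * (D + 2 * S) := by
    have h4 : S ^ 2 ≤ r * ((∑ k ∈ range r, p k ^ 2 - ∑ k ∈ range r, t k ^ 2) + 2 * S) :=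
      h2.trans (mul_le_mul_of_nonneg_left h1 (by positivity))
    have h5 : (S : ℝ) ^ 2 ≤
        r * (((∑ k ∈ range r, p k ^ 2 - ∑ k ∈ range r, t k ^ 2 : ℤ) : ℝ) + 2 * S) := by
      exact_mod_cast h4
    refine h5.trans (mul_le_mul_of_nonneg_left ?_ (by positivity))
    linarith
  -- Cauchy–Schwarz has given S² ≤ r(D + 2S), which S > 3rs contradicts because s ≥ 1 and D ≤ s².
  by_contra! hlt
  have hr1 : (1 : ℝ) ≤ r := by exact_mod_cast hr
  have hrs : 0 < (r : ℝ) * s := by positivity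
  have hS0 : 0 < (S : ℝ) := by linarith
  have a1 : 3 * r * s * S < (S : ℝ) ^ 2 := by rw [sq]; exact mul_lt_mul_of_pos_right hlt hS0
  have a2 : (r : ℝ) * S ≤ r * s * S := by
    rw [mul_assoc]
    exact mul_le_mul_of_nonneg_left (le_mul_of_one_le_left hS0.le hs) (by positivity)
  have a3 : (r : ℝ) * s * (3 * r * s) ≤ r * s * S := mul_le_mul_of_nonneg_left hlt.le hrs.le
  have a4 : (r : ℝ) * D ≤ r * s ^ 2 := mul_le_mul_of_nonneg_left hsD (by positivity)
  have a5 : (r : ℝ) * s ^ 2 ≤ r * s * (3 * r * s) := by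
    have : (r : ℝ) * s ^ 2 * 1 ≤ r * s ^ 2 * (3 * r) :=
      mul_le_mul_of_nonneg_left (by linarith) (by positivity)
    linarith
  linarith

/-- A `K_{r+1}`-free graph with nearly as many edges as the Turán graph is close to it. -/
theorem editDist_turanGraph_le {r n : ℕ} (hr : 0 < r) {G : SimpleGraph (Fin n)}
    (hG : G.CliqueFree (r + 1)) {s : ℝ} (hs1 : s ≤ 1) (hs0 : 0 < s)
    (h : (#(adjPairs (SimpleGraph.turanGraph n r)) : ℝ) - #(adjPairs G) ≤ (s * n) ^ 2) :
    (editDist G (SimpleGraph.turanGraph n r) : ℝ) ≤ 9 * r * s * n ^ 2 := by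
  set T := SimpleGraph.turanGraph n r with hT
  by_cases hle : #(adjPairs T) ≤ #(adjPairs G)
  · obtain ⟨e⟩ := nonempty_iso_turanGraph hr hG hle
    rw [editDist_eq_zero e, Nat.cast_zero]
    positivity
  push Not at hle
  have hD1 : (1 : ℝ) ≤ #(adjPairs T) - #(adjPairs G) := by
    have : (#(adjPairs G) : ℝ) + 1 ≤ #(adjPairs T) := by exact_mod_cast hle
    linarith
  -- A nonzero deficit is an integer, hence at least 1.
  have hsn : 1 ≤ s * n := by
    have : 0 ≤ s * n := by positivity
    nlinarith
  obtain ⟨f, hf, hfG, hclose⟩ := exists_multipartite_close hG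
  have hK := card_adjPairs_le_turanGraph hr (multipartite_cliqueFree hf)
  rw [← hT] at hK
  have hmod : ∀ v : Fin n, (v : ℕ) % r < r := fun v => Nat.mod_lt _ hr
  have e1 := card_adjPairs_multipartite hf
  have e2 := card_adjPairs_multipartite hmod
  rw [← turanGraph_eq_multipartite, ← hT] at e2
  have hsf := sum_card_fiber hf
  have hst := sum_card_fiber hmod
  have habs := sum_abs_sub_le (q := n / r) (p := fun k => (#{v | f v = k} : ℤ))
    (t := fun k => (#{v : Fin n | (v : ℕ) % r = k} : ℤ)) (D := #(adjPairs T) - #(adjPairs G))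
    (s := s * n) hr (by exact_mod_cast hsf.trans hst.symm)
    (fun k hk => by exact_mod_cast card_fiber_mod (n := n) (mem_range.1 hk))
    (by
      have e1' := congrArg (Nat.cast : ℕ → ℝ) e1
      have e2' := congrArg (Nat.cast : ℕ → ℝ) e2
      have : (#(adjPairs G) : ℝ) ≤ #(adjPairs (multipartite f)) := by
        exact_mod_cast hfG
      push_cast at e1' e2' ⊢
      linarith) hsn h
  obtain ⟨g, hg, hgt, hgf⟩ := exists_recolouring (t := fun k => #{v : Fin n | (v : ℕ) % r = k})
    hst _ f hf le_rfl
  have hZ : (#{v | f v ≠ g v} : ℝ) ≤ 3 * r * (s * n) := by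
    refine le_trans ?_ habs
    have : (#{v | f v ≠ g v} : ℤ) ≤ ∑ k ∈ range r,
        |(#{v | f v = k} : ℤ) - #{v : Fin n | (v : ℕ) % r = k}| := by
      refine (Nat.cast_le.2 hgf).trans ?_
      rw [Nat.cast_sum]
      refine sum_le_sum fun k _ => ?_
      rcases le_total #{v | f v = k} #{v : Fin n | (v : ℕ) % r = k} with h | h
      · rw [Nat.sub_eq_zero_of_le h]
        exact abs_nonneg _
      · rw [Nat.cast_sub h]
        exact le_abs_self _
    exact_mod_cast this
  have b5 := hclose g T (nonempty_iso_of_card_fiber_eq hg hmod hgt)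
  rw [Fintype.card_fin] at b5
  have b6 : (editDist G T : ℝ) + 3 * #(adjPairs G) ≤
      3 * #(adjPairs T) + 2 * (n * #{v | f v ≠ g v}) := by
    exact_mod_cast b5.trans (Nat.add_le_add_right (Nat.mul_le_mul_left 3 hK) _)
  have b7 : (n : ℝ) * #{v | f v ≠ g v} ≤ n * (3 * r * (s * n)) :=
    mul_le_mul_of_nonneg_left hZ (by positivity)
  -- The constant 9 is 3 from the edge deficit plus 2 · 3 from the recoloured vertices.
  have b8 : (s * n) ^ 2 ≤ r * s * n ^ 2 := by
    have hr1 : (1 : ℝ) ≤ r := by exact_mod_cast hr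
    have : s * s ≤ r * s := mul_le_mul_of_nonneg_right (hs1.trans hr1) hs0.le
    calc (s * n) ^ 2 = s * s * n ^ 2 := by ring
      _ ≤ _ := mul_le_mul_of_nonneg_right this (by positivity)
  linarith

/-! ### Labelled and unlabelled copies, and the conclusion -/

/-- Precomposition with automorphisms of H is free and transitive on the copies with a given image.
-/
theorem card_copies_with_subgraph {V : Type*} {H : SimpleGraph W} {G : SimpleGraph V} (f : H.Copy G) :
    Nat.card {f' : H.Copy G // f'.toSubgraph = f.toSubgraph} = Nat.card (H ≃g H) := by
  symm
  have hrange (f' : H.Copy G) : f'.toSubgraph.verts = Set.range f' := by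
    simp [SimpleGraph.Copy.toSubgraph]
  have hadj (f' : H.Copy G) (a b : W) : f'.toSubgraph.Adj (f' a) (f' b) ↔ H.Adj a b := by
    simp only [SimpleGraph.Copy.toSubgraph, SimpleGraph.Subgraph.map_adj]
    constructor
    · rintro ⟨x, y, h, hx, hy⟩
      rw [← f'.injective hx, ← f'.injective hy]
      simpa using h
    · intro h
      exact ⟨a, b, by simpa using h, rfl, rfl⟩
  refine Nat.card_congr (Equiv.ofBijective (fun α => ⟨f.comp α.toCopy, ?_⟩) ⟨?_, ?_⟩)
  · simp [SimpleGraph.Copy.toSubgraph, SimpleGraph.Copy.comp, SimpleGraph.Subgraph.map_comp]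
  · intro α β h
    ext a
    exact f.injective (DFunLike.congr_fun (congrArg Subtype.val h) a)
  · rintro ⟨f', hf'⟩
    have hr : Set.range f' = Set.range f := by rw [← hrange, ← hrange, hf']
    have key : ∀ a, ∃ b, f b = f' a := fun a => by
      have : f' a ∈ Set.range f := hr ▸ ⟨a, rfl⟩
      exact this
    choose α hα using key
    have hbij : Function.Bijective α := by
      refine (Finite.injective_iff_bijective).1 fun x y h => f'.injective ?_
      exact (hα x).symm.trans ((congrArg f h).trans (hα y))
    refine ⟨⟨Equiv.ofBijective α hbij, fun {a b} => ?_⟩, ?_⟩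
    · simp only [Equiv.ofBijective_apply]
      rw [← hadj f, hα, hα, ← hf', hadj]
    · refine Subtype.ext (DFunLike.ext _ _ fun a => ?_)
      exact hα a

theorem labelledCopyCount_eq_mul_copyCount (H : SimpleGraph W) (G : SimpleGraph V) :
    G.labelledCopyCount H = Nat.card (H ≃g H) * G.copyCount H := by
  rw [SimpleGraph.copyCount_eq_card_image_copyToSubgraph, SimpleGraph.labelledCopyCount,
    ← card_univ, card_eq_sum_card_image SimpleGraph.Copy.toSubgraph,
    sum_const_nat (m := Nat.card (H ≃g H)), mul_comm]
  intro S hS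
  obtain ⟨f, -, rfl⟩ := mem_image.1 hS
  rw [← card_copies_with_subgraph f, Nat.card_eq_fintype_card, Fintype.card_subtype]

/-- Each of the h − 2 factors of the falling factorial is at least n − h + 1 ≥ n/h. -/
theorem pow_le_pow_mul_extCount {n : ℕ} (h2 : 2 ≤ Fintype.card W) (hn : Fintype.card W ≤ n) :
    n ^ (Fintype.card W - 2) ≤
      Fintype.card W ^ (Fintype.card W - 2) * extCount W (Fin n) 2 := by
  rw [extCount, Fintype.card_fin]
  refine le_trans ?_ (Nat.mul_le_mul_left _ (Nat.pow_sub_le_descFactorial _ _))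
  rw [← mul_pow]
  refine Nat.pow_le_pow_left ?_ _
  obtain ⟨g, hg⟩ : ∃ g, Fintype.card W = g + 2 := ⟨Fintype.card W - 2, by omega⟩
  obtain ⟨m, rfl⟩ : ∃ m, n = m + Fintype.card W := ⟨n - Fintype.card W, by omega⟩
  rw [hg, show m + (g + 2) - 2 + 1 - (g + 2 - 2) = m + 1 by omega]
  nlinarith

/-- Stability for labelled copies. -/
theorem exists_labelled_stability {H : SimpleGraph W} (hH : H ≠ ⊥) {r : ℕ}
    (hr : 300 * Fintype.card W ^ 9 ≤ r) {ε : ℝ} (hε : 0 < ε) :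
    ∃ δ : ℝ, 0 < δ ∧ ∀ n : ℕ, Fintype.card W ≤ n → ∀ G : SimpleGraph (Fin n),
      (⊤ : SimpleGraph (Fin (r + 1))).Free G →
      ((SimpleGraph.turanGraph n r).labelledCopyCount H : ℝ) - δ * (n : ℝ) ^ Fintype.card W
        ≤ (G.labelledCopyCount H : ℝ) →
      (editDist G (SimpleGraph.turanGraph n r) : ℝ) ≤ ε * (n : ℝ) ^ 2 := by
  obtain ⟨a, b, hab⟩ := SimpleGraph.ne_bot_iff_exists_adj.1 hH
  have h2 := two_le_card_of_ne hab.ne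
  have hr0 : 0 < r := by
    have : 1 ≤ Fintype.card W ^ 9 := Nat.one_le_pow _ _ (by omega)
    omega
  have hrR : (0 : ℝ) < r := by exact_mod_cast hr0
  -- Chosen so that 9rs ≤ ε; then δ = s²/(rc) bounds the deficit of ordered pairs by (sn)².
  set s : ℝ := min 1 (ε / (9 * r)) with hs
  have hs0 : 0 < s := lt_min one_pos (by positivity)
  set c : ℝ := (Fintype.card W : ℝ) ^ (Fintype.card W - 2) with hc
  have hc0 : 0 < c := pow_pos (by exact_mod_cast (by omega : 0 < Fintype.card W)) _
  refine ⟨s ^ 2 / (r * c), by positivity, fun n hn G hfree hcount => ?_⟩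
  have hG : G.CliqueFree (r + 1) := by
    rw [SimpleGraph.cliqueFree_iff_top_free (β := Fin (r + 1)) |>.symm] at hfree
    simpa using hfree
  have hn0 : (0 : ℝ) < n := by exact_mod_cast (by omega : 0 < n)
  rw [labelledCopyCount_eq_card_injHoms, labelledCopyCount_eq_card_injHoms] at hcount
  have hb := turan_bound hH hr hn hG
  have hF := pow_le_pow_mul_extCount h2 hn
  set T := SimpleGraph.turanGraph n r with hT
  have hle := card_adjPairs_le_turanGraph hr0 hG
  rw [← hT] at hle
  set F := extCount W (Fin n) 2 with hFdef
  have hb' : (r : ℝ) * #(injHoms H G) + F * #(adjPairs T) ≤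
      r * #(injHoms H T) + F * #(adjPairs G) := by exact_mod_cast hb
  have hF' : (n : ℝ) ^ (Fintype.card W - 2) ≤ c * F := by rw [hc]; exact_mod_cast hF
  have hle' : (0 : ℝ) ≤ #(adjPairs T) - #(adjPairs G) := sub_nonneg.2 (by exact_mod_cast hle)
  have hpow : (n : ℝ) ^ Fintype.card W = n ^ (Fintype.card W - 2) * n ^ 2 := by
    rw [← pow_add]; congr 1; omega
  have key : (#(adjPairs T) : ℝ) - #(adjPairs G) ≤ (s * n) ^ 2 := by
    refine le_of_mul_le_mul_left ?_ (pow_pos hn0 (Fintype.card W - 2))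
    calc (n : ℝ) ^ (Fintype.card W - 2) * (#(adjPairs T) - #(adjPairs G))
        ≤ c * F * (#(adjPairs T) - #(adjPairs G)) := mul_le_mul_of_nonneg_right hF' hle'
      _ = c * (F * (#(adjPairs T) - #(adjPairs G))) := by ring
      _ ≤ c * (r * (s ^ 2 / (r * c) * (n : ℝ) ^ Fintype.card W)) := by
          refine mul_le_mul_of_nonneg_left ?_ hc0.le
          have := mul_le_mul_of_nonneg_left hcount hrR.le
          linarith
      _ = n ^ (Fintype.card W - 2) * (s * n) ^ 2 := by
          rw [hpow]; field_simp
  refine (editDist_turanGraph_le hr0 hG (min_le_left _ _) hs0 key).trans ?_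
  refine mul_le_mul_of_nonneg_right ?_ (by positivity)
  have : s ≤ ε / (9 * r) := min_le_right _ _
  rw [le_div_iff₀ (by positivity)] at this
  linarith

end

end TuranStability

/-- `labelledCopyCount G H` is the number of injective homomorphisms from `H` to `G`. -/
theorem theorem2 {W : Type*} [Fintype W] (H : SimpleGraph W) (hH : H ≠ ⊥) (r : ℕ)
    (hr : 300 * Fintype.card W ^ 9 ≤ r) :
    TuranStability.IsTuranStable H (⊤ : SimpleGraph (Fin (r + 1))) r ∧
    ∀ ε : ℝ, 0 < ε → ∃ δ : ℝ, 0 < δ ∧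
      ∀ n : ℕ, Fintype.card W ≤ n → ∀ G : SimpleGraph (Fin n),
        (⊤ : SimpleGraph (Fin (r + 1))).Free G →
        ((SimpleGraph.turanGraph n r).labelledCopyCount H : ℝ) - δ * (n : ℝ) ^ Fintype.card W
          ≤ (G.labelledCopyCount H : ℝ) →
        (TuranStability.editDist G (SimpleGraph.turanGraph n r) : ℝ) ≤ ε * (n : ℝ) ^ 2 := by
  have hW : Fintype.card W ≠ 0 := by
    obtain ⟨a, b, hab⟩ := SimpleGraph.ne_bot_iff_exists_adj.1 hH
    have := TuranStability.two_le_card_of_ne hab.ne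
    omega
  have hWr : Fintype.card W ≤ r :=
    (Nat.le_self_pow (by norm_num) _).trans ((Nat.le_mul_of_pos_left _ (by norm_num)).trans hr)
  refine ⟨⟨?_, ?_, fun ε hε => ?_⟩, fun ε hε =>
    TuranStability.exists_labelled_stability hH hr hε⟩
  · simp
  · exact (SimpleGraph.chromaticNumber_le_card (G := H)).trans (by exact_mod_cast hWr)
  · obtain ⟨δ, hδ, h⟩ := TuranStability.exists_labelled_stability hH hr hε
    set k := Nat.card (H ≃g H) with hk
    have : Finite (H ≃g H) := Finite.of_injective _ RelIso.toEquiv_injective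
    have hk0 : 0 < k := Nat.card_pos
    have hkR : (0 : ℝ) < k := by exact_mod_cast hk0
    -- Labelled counts are `k` = |Aut H| times unlabelled ones. Of `genEx` only its being at least
    -- the count in the Turán graph is needed.
    refine ⟨δ / k, by positivity, fun n hn G hG hcount => h n hn G hG ?_⟩
    rw [TuranStability.labelledCopyCount_eq_mul_copyCount,
      TuranStability.labelledCopyCount_eq_mul_copyCount, ← hk]
    have hT : (⊤ : SimpleGraph (Fin (r + 1))).Free (SimpleGraph.turanGraph n r) := by
      rw [← SimpleGraph.cliqueFree_iff_top_free]
      simpa using SimpleGraph.turanGraph_cliqueFree (n := n) (by omega : 0 < r)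
    have hex : (SimpleGraph.turanGraph n r).copyCount H ≤
        TuranStability.genEx n H (⊤ : SimpleGraph (Fin (r + 1))) := by
      classical
      exact Finset.le_sup (f := fun G : SimpleGraph (Fin n) => G.copyCount H)
        (Finset.mem_filter.2 ⟨Finset.mem_univ _, hT⟩)
    have hex' : ((SimpleGraph.turanGraph n r).copyCount H : ℝ) ≤
        TuranStability.genEx n H (⊤ : SimpleGraph (Fin (r + 1))) := by exact_mod_cast hex
    have h1 : ((SimpleGraph.turanGraph n r).copyCount H : ℝ) - δ / k * (n : ℝ) ^ Fintype.card W ≤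
        G.copyCount H := by linarith
    have h2 := mul_le_mul_of_nonneg_left h1 hkR.le
    have h3 : (k : ℝ) * (δ / k * (n : ℝ) ^ Fintype.card W) = δ * (n : ℝ) ^ Fintype.card W := by
      field_simp
    push_cast
    linarith
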